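/- **Setting.** Let $M$ (men) and $W$ (women) be sets with $|M|=|W|=n$, where every agent has a true strict total order over the agents of the other side; write $\succ$ for this profile. For reported lists $\mathbf p=(\mathbf p_m)_{m\in M}$ of the men, let $\mu_{\mathbf p}$ be the matching returned by the men-proposing deferred acceptance algorithm when the men report $\mathbf p$ and the women report truthfully, and let $\mathcal S_{\mathbf p}$ be the set of stable matchings for these reports. Let $P\subseteq M\times W$ be a set of strategic pairs. In the *accomplice manipulation game* with strategic pairs $P$, every man who occurs in a pair of $P$ may report any strict total order over $W$; all other agents report truthfully. At a profile $\mathbf p$, an *accomplice manipulation* by a pair $(m,w)\in P$ is a list $\mathbf p'_m$ such that, with $\mathbf p'=(\mathbf p_{-m},\mathbf p'_m)$, the woman $w$ strictly prefers $\mu_{\mathbf p'}(w)$ to $\mu_{\mathbf p}(w)$, and the man $m$ weakly prefers $\mu_{\mathbf p'}(m)$ to $\mu_{\mathbf p}(m)$, both in the true preferences. A profile $\mathbf p$ of the game is a *(pure-strategy) Nash equilibrium* if no pair $(m,w)\in P$ has an accomplice manipulation at $\mathbf p$. The list $\mathbf p'_m$ is a *push-up* of $\mathbf p_m$ if there is a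 set $X\subseteq W\setminus\{\mu_{\mathbf p}(m)\}$ such that the women above $\mu_{\mathbf p}(m)$ in $\mathbf p'_m$ are those above $\mu_{\mathbf p}(m)$ in $\mathbf p_m$ together with those of $X$, in any order, while the women below $\mu_{\mathbf p}(m)$ in $\mathbf p'_m$ are ordered as in $\mathbf p_m$. A *push-up dynamic* is a sequence of profiles $\mathbf p^{(0)},\mathbf p^{(1)},\dots$ that starts with the true lists of the men, and in which $\mathbf p^{(t+1)}$ results from $\mathbf p^{(t)}$ by an accomplice manipulation of some pair of $P$ that is a push-up, if there is one, and $\mathbf p^{(t+1)}=\mathbf p^{(t)}$ otherwise. **Theorem.** For every $n$, every such preference profile and every $P\subseteq M\times W$: 1. The accomplice manipulation game with strategic pairs $P$ has a pure-strategy Nash equilibrium. 2. Every push-up dynamic satisfies the following. For all $t$, $\mathcal S_{\mathbf p^{(t+1)}}\subseteq\mathcal S_{\mathbf p^{(t)}}$. Whenever $\mathbf p^{(t+1)}\neq\mathbf p^{(t)}$, every woman weakly prefers $\mu_{\mathbf p^{(t+1)}}$ to $\mu_{\mathbf p^{(t)}}$, and some woman strictly does. There is $t\le n^2$ such that $\mathbf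 p^{(s)}=\mathbf p^{(t)}$ for all $s\ge t$, and $\mathbf p^{(t)}$ is a Nash equilibrium, that is, no pair of $P$ has an accomplice manipulation of any kind (push-up or not) at $\mathbf p^{(t)}$. 3. A Nash equilibrium can be computed in polynomial time: there are one algorithm (a program for a unit-cost random access machine with addition and subtraction) and one polynomial $T$ such that for every $n$, every preference profile and every $P$, given as input, the algorithm halts after at most $T(n)$ steps and outputs a Nash equilibrium of the game. -/

import Mathlib

namespace AccompliceGame

/-! ### Stable matching instances

An instance with `n` men and `n` women; men and women are both indexed by `Fin n`. -/

/-- A preference list (strict total order) over the `n` agents of the other side, written from best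
to worst: `l k` is the agent in position `k`, and `l.symm a` is the position of the agent `a`. -/
abbrev PrefList (n : ℕ) : Type := Equiv.Perm (Fin n)

/-- Under the list `l`, the agent `a` is strictly preferred to the agent `b`. -/
def Prefers {n : ℕ} (l : PrefList n) (a b : Fin n) : Prop := l.symm a < l.symm b

/-- Under the list `l`, the agent `a` is weakly preferred to the agent `b`. -/
def WeaklyPrefers {n : ℕ} (l : PrefList n) (a b : Fin n) : Prop := a = b ∨ Prefers l a b

instance {n : ℕ} (l : PrefList n) (a b : Fin n) : Decidable (Prefers l a b) :=
  inferInstanceAs (Decidable (l.symm a < l.symm b))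

/-- The lists of all agents of one side of the market. -/
abbrev Profile (n : ℕ) : Type := Fin n → PrefList n

/-- A stable matching instance: the true preference lists of the men and of the women. -/
structure Market (n : ℕ) where
  men : Profile n
  women : Profile n

/-- A matching: `μ m` is the partner of the man `m`, and `μ.symm w` the partner of the woman `w`. -/
abbrev Matching (n : ℕ) : Type := Equiv.Perm (Fin n)

/-- `(m, w)` blocks `μ`, when the men report `p` and the women report `q`. -/
def IsBlockingPair {n : ℕ} (q p : Profile n) (μ : Matching n) (m w : Fin n) : Prop :=
  Prefers (p m) w (μ m) ∧ Prefers (q w) m (μ.symm w)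

/-- The set of stable matchings, when the men report `p` and the women report `q`. -/
def stableSet {n : ℕ} (q p : Profile n) : Set (Matching n) :=
  {μ | ∀ m w, ¬ IsBlockingPair q p μ m w}

/-! ### The deferred acceptance algorithm

The state of the algorithm is the number `r m` of rejections that each man `m` has received so far;
since he goes down his list, he addresses (newly or as a still standing proposal) the woman in
position `r m` of his list. -/

/-- The man `m` proposes to the woman `w`, or is tentatively accepted by her. -/
def ProposesTo {n : ℕ} (p : Profile n) (r : Fin n → ℕ) (m w : Fin n) : Prop :=
  ((p m).symm w : ℕ) = r m

instance {n : ℕ} (p : Profile n) (r : Fin n → ℕ) (m w : Fin n) : Decidable (ProposesTo p r m w) :=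
  inferInstanceAs (Decidable (((p m).symm w : ℕ) = r m))

/-- The man `m` is rejected in the current round: the woman he addresses has a proposal that she
prefers to his. -/
def IsRejected {n : ℕ} (q p : Profile n) (r : Fin n → ℕ) (m : Fin n) : Prop :=
  ∃ w m', ProposesTo p r m w ∧ ProposesTo p r m' w ∧ Prefers (q w) m' m

instance {n : ℕ} (q p : Profile n) (r : Fin n → ℕ) (m : Fin n) : Decidable (IsRejected q p r m) :=
  inferInstanceAs (Decidable (∃ w m', ProposesTo p r m w ∧ ProposesTo p r m' w ∧ Prefers (q w) m' m))

/-- One round (proposal phase and rejection phase). -/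
def daRound {n : ℕ} (q p : Profile n) (r : Fin n → ℕ) : Fin n → ℕ :=
  fun m => if IsRejected q p r m then r m + 1 else r m

/-- The state after `t` rounds. -/
def daState {n : ℕ} (q p : Profile n) (t : ℕ) : Fin n → ℕ := (daRound q p)^[t] (fun _ => 0)

theorem daState_succ {n : ℕ} (q p : Profile n) (t : ℕ) :
    daState q p (t + 1) = daRound q p (daState q p t) :=
  Function.iterate_succ_apply' _ _ _

theorem ProposesTo.unique {n : ℕ} {p : Profile n} {r : Fin n → ℕ} {m w w' : Fin n}
    (h : ProposesTo p r m w) (h' : ProposesTo p r m w') : w = w' :=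
  (p m).symm.injective (Fin.ext (h.trans h'.symm))

/-- Every woman who has rejected a man holds a proposal that she prefers to him. -/
theorem daState_inv {n : ℕ} (q p : Profile n) (t : ℕ) (m w : Fin n)
    (h : ((p m).symm w : ℕ) < daState q p t m) :
    ∃ m', ProposesTo p (daState q p t) m' w ∧ Prefers (q w) m' m := by
  induction t generalizing m w with
  | zero => exact absurd h (Nat.not_lt_zero _)
  | succ t ih =>
    have key : ∃ m', ProposesTo p (daState q p t) m' w ∧ Prefers (q w) m' m := by
      rw [daState_succ, daRound] at h
      split_ifs at h with hr
      · rcases Nat.lt_succ_iff_lt_or_eq.1 h with h | h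
        · exact ih m w h
        · obtain ⟨w', m', h1, h2, h3⟩ := hr
          obtain rfl : w = w' := ProposesTo.unique (show ProposesTo p _ m w from h) h1
          exact ⟨m', h2, h3⟩
      · exact ih m w h
    obtain ⟨m', hm', hpref⟩ := key
    obtain ⟨b, hb, hbest⟩ := Finset.exists_min_image
      (Finset.univ.filter fun x => ProposesTo p (daState q p t) x w) (fun x => (q w).symm x)
      ⟨m', by simpa using hm'⟩
    simp only [Finset.mem_filter, Finset.mem_univ, true_and] at hb hbest
    refine ⟨b, ?_, lt_of_le_of_lt (hbest m' hm') hpref⟩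
    have hnr : ¬ IsRejected q p (daState q p t) b := by
      rintro ⟨w', x, h1, h2, h3⟩
      obtain rfl : w = w' := hb.unique h1
      exact absurd (hbest x h2) (not_le.2 h3)
    rw [daState_succ, ProposesTo, daRound, if_neg hnr]
    exact hb

/-- No man is rejected by all women. -/
theorem daState_lt {n : ℕ} (q p : Profile n) (t : ℕ) (m : Fin n) : daState q p t m < n := by
  by_contra hn
  have hall : ∀ w, ∃ m', ProposesTo p (daState q p t) m' w ∧ Prefers (q w) m' m := fun w =>
    daState_inv q p t m w (lt_of_lt_of_le ((p m).symm w).2 (not_lt.1 hn))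
  choose f hf hf' using hall
  have hinj : Function.Injective f := fun w w' h =>
    (hf w).unique (by rw [h]; exact hf w')
  obtain ⟨w, hw⟩ := Finite.surjective_of_injective hinj m
  have := hf' w
  rw [hw] at this
  exact lt_irrefl _ this

/-- After `n * n` rounds, no man is rejected any more: the algorithm has terminated. -/
theorem daState_final {n : ℕ} (q p : Profile n) (m : Fin n) :
    ¬ IsRejected q p (daState q p (n * n)) m := by
  have hstep : ∀ t, (∀ m, ¬ IsRejected q p (daState q p t) m) ∨ t ≤ ∑ m, daState q p t m := by
    intro t
    induction t with
    | zero => exact Or.inr (Nat.zero_le _)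
    | succ t ih =>
      by_cases hfix : ∀ m, ¬ IsRejected q p (daState q p t) m
      · left
        have : daState q p (t + 1) = daState q p t := by
          rw [daState_succ]
          funext m
          exact if_neg (hfix m)
        rwa [this]
      · right
        have h1 := ih.resolve_left hfix
        push Not at hfix
        obtain ⟨m₀, hm₀⟩ := hfix
        refine lt_of_le_of_lt h1 (Finset.sum_lt_sum (fun m _ => ?_) ⟨m₀, Finset.mem_univ _, ?_⟩)
        · rw [daState_succ, daRound]
          split_ifs <;> omega
        · rw [daState_succ, daRound, if_pos hm₀]
          omega
  refine (hstep (n * n)).resolve_right (fun h => ?_) m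
  have : ∑ x, daState q p (n * n) x < ∑ _x : Fin n, n :=
    Finset.sum_lt_sum_of_nonempty ⟨m, Finset.mem_univ _⟩ (fun x _ => daState_lt q p _ x)
  simp at this
  omega

/-- The woman whom the man `m` addresses when the algorithm terminates. -/
def daPartner {n : ℕ} (q p : Profile n) (m : Fin n) : Fin n :=
  p m ⟨daState q p (n * n) m, daState_lt q p (n * n) m⟩

theorem daPartner_injective {n : ℕ} (q p : Profile n) : Function.Injective (daPartner q p) := by
  have hprop : ∀ m, ProposesTo p (daState q p (n * n)) m (daPartner q p m) := fun m => by
    simp [ProposesTo, daPartner]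
  intro m m' h
  rcases lt_trichotomy ((q (daPartner q p m)).symm m) ((q (daPartner q p m)).symm m') with hl | he | hg
  · exact absurd ⟨daPartner q p m, m, by rw [h]; exact hprop m', hprop m, hl⟩
      (daState_final q p m')
  · exact (q (daPartner q p m)).symm.injective he
  · exact absurd ⟨daPartner q p m, m', hprop m, by rw [h]; exact hprop m', hg⟩
      (daState_final q p m)

/-- The (men-proposing) deferred acceptance matching, when the men report `p` and the women report
`q`. -/
noncomputable def DA {n : ℕ} (q p : Profile n) : Matching n :=
  Equiv.ofBijective (daPartner q p) (Finite.injective_iff_bijective.1 (daPartner_injective q p))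

/-! ### The accomplice manipulation game

The women report truthfully. `P` is the set of strategic pairs (man, woman). -/

/-- A strategy profile of the game: the men of the strategic pairs may report any list, all others
report truthfully. -/
def IsStrategyProfile {n : ℕ} (I : Market n) (P : Finset (Fin n × Fin n)) (p : Profile n) : Prop :=
  ∀ m, (∀ w, (m, w) ∉ P) → p m = I.men m

/-- At the profile `p`, the report `l` of the man `m` is an accomplice manipulation for the pair
`(m, w)`: the woman `w` gets a strictly better partner and the man `m` a weakly better one, both in
the true preferences. -/
def IsManipulation {n : ℕ} (I : Market n) (p : Profile n) (m w : Fin n) (l : PrefList n) : Prop :=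
  Prefers (I.women w) ((DA I.women (Function.update p m l)).symm w) ((DA I.women p).symm w) ∧
    WeaklyPrefers (I.men m) (DA I.women (Function.update p m l) m) (DA I.women p m)

/-- Pure-strategy Nash equilibrium. -/
def IsNashEquilibrium {n : ℕ} (I : Market n) (P : Finset (Fin n × Fin n)) (p : Profile n) : Prop :=
  IsStrategyProfile I P p ∧ ∀ m w, (m, w) ∈ P → ∀ l, ¬ IsManipulation I p m w l

/-- The list `l'` results from `l` by pushing up a set `X` of women above the woman `b`: the women
above `b` are now those who were above `b` before and those of `X` (in any order); the women who
stay below `b` keep their order. -/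
def IsPushUp {n : ℕ} (l l' : PrefList n) (b : Fin n) : Prop :=
  ∃ X : Finset (Fin n), b ∉ X ∧
    (∀ w, Prefers l' w b ↔ Prefers l w b ∨ w ∈ X) ∧
    (∀ w₁ w₂, Prefers l' b w₁ → Prefers l' b w₂ → (Prefers l' w₁ w₂ ↔ Prefers l w₁ w₂))

/-- `p'` results from `p` by an accomplice manipulation of some strategic pair that is performed by
pushing up a set of women above the manipulator's current partner. -/
def IsPushUpStep {n : ℕ} (I : Market n) (P : Finset (Fin n × Fin n)) (p p' : Profile n) : Prop :=
  ∃ m w l, (m, w) ∈ P ∧ IsManipulation I p m w l ∧ IsPushUp (p m) l (DA I.women p m) ∧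
    p' = Function.update p m l

/-- A push-up dynamic: it starts at the truthful profile, performs a push-up accomplice manipulation
whenever there is one, and otherwise stays where it is. -/
def IsPushUpDynamic {n : ℕ} (I : Market n) (P : Finset (Fin n × Fin n)) (p : ℕ → Profile n) : Prop :=
  p 0 = I.men ∧
    ∀ t, IsPushUpStep I P (p t) (p (t + 1)) ∨
      ((¬ ∃ p', IsPushUpStep I P (p t) p') ∧ p (t + 1) = p t)

/-! ### Random access machines and their running time

A unit-cost random access machine. It has registers, which a program names by fixed numbers, and a
memory, which it addresses through registers. The arithmetic is addition and truncated subtraction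
only (no multiplication), so that time polynomial on this machine is time polynomial on a Turing
machine. -/

/-- The contents of the registers and of the memory. -/
structure RamState where
  reg : ℕ → ℕ
  mem : ℕ → ℕ

/-- Programs of the machine. -/
inductive Program : Type
  /-- do nothing -/
  | skip : Program
  /-- `reg d := c` -/
  | const (d c : ℕ) : Program
  /-- `reg d := reg a + reg b` -/
  | add (d a b : ℕ) : Program
  /-- `reg d := reg a - reg b`, and `0` if this is negative -/
  | sub (d a b : ℕ) : Program
  /-- `reg d := mem (reg a)` -/
  | load (d a : ℕ) : Program
  /-- `mem (reg a) := reg b` -/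
  | store (a b : ℕ) : Program
  /-- first `c₁`, then `c₂` -/
  | seq (c₁ c₂ : Program) : Program
  /-- if `reg a ≠ 0` then `c₁` else `c₂` -/
  | ite (a : ℕ) (c₁ c₂ : Program) : Program
  /-- while `reg a ≠ 0` do `c` -/
  | loop (a : ℕ) (c : Program) : Program

/-- `Exec c s t s'`: started in the state `s`, the program `c` halts after exactly `t` steps, in the
state `s'`. Every instruction and every test of a register counts as one step. -/
inductive Exec : Program → RamState → ℕ → RamState → Prop
  | skip (s : RamState) : Exec Program.skip s 1 s
  | const (d c : ℕ) (s : RamState) :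
      Exec (Program.const d c) s 1 ⟨Function.update s.reg d c, s.mem⟩
  | add (d a b : ℕ) (s : RamState) :
      Exec (Program.add d a b) s 1 ⟨Function.update s.reg d (s.reg a + s.reg b), s.mem⟩
  | sub (d a b : ℕ) (s : RamState) :
      Exec (Program.sub d a b) s 1 ⟨Function.update s.reg d (s.reg a - s.reg b), s.mem⟩
  | load (d a : ℕ) (s : RamState) :
      Exec (Program.load d a) s 1 ⟨Function.update s.reg d (s.mem (s.reg a)), s.mem⟩
  | store (a b : ℕ) (s : RamState) :
      Exec (Program.store a b) s 1 ⟨s.reg, Function.update s.mem (s.reg a) (s.reg b)⟩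
  | seq {c₁ c₂ : Program} {s₁ s₂ s₃ : RamState} {t₁ t₂ : ℕ} :
      Exec c₁ s₁ t₁ s₂ → Exec c₂ s₂ t₂ s₃ → Exec (Program.seq c₁ c₂) s₁ (t₁ + t₂) s₃
  | ite_true {a : ℕ} {c₁ c₂ : Program} {s s' : RamState} {t : ℕ} :
      s.reg a ≠ 0 → Exec c₁ s t s' → Exec (Program.ite a c₁ c₂) s (t + 1) s'
  | ite_false {a : ℕ} {c₁ c₂ : Program} {s s' : RamState} {t : ℕ} :
      s.reg a = 0 → Exec c₂ s t s' → Exec (Program.ite a c₁ c₂) s (t + 1) s'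
  | loop_done {a : ℕ} {c : Program} {s : RamState} :
      s.reg a = 0 → Exec (Program.loop a c) s 1 s
  | loop_again {a : ℕ} {c : Program} {s₁ s₂ s₃ : RamState} {t₁ t₂ : ℕ} :
      s₁.reg a ≠ 0 → Exec c s₁ t₁ s₂ → Exec (Program.loop a c) s₂ t₂ s₃ →
        Exec (Program.loop a c) s₁ (t₁ + t₂ + 1) s₃

/-- An `n × n` table stored row by row: the entry `f i j` is at the address `n * i + j`. -/
def table {n : ℕ} (f : Fin n → Fin n → ℕ) (a : ℕ) : ℕ :=
  if h : a < n * n then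
    f ⟨a / n, Nat.div_lt_of_lt_mul h⟩
      ⟨a % n, Nat.mod_lt a (Nat.pos_of_mul_pos_left (Nat.zero_lt_of_lt h))⟩
  else 0

/-- The input: register `0` holds `n`, and the memory holds the true lists of the men, then those of
the women, then the table of the strategic pairs (`1` for a member of `P`, `0` otherwise). All else
is `0`. -/
def inputState {n : ℕ} (I : Market n) (P : Finset (Fin n × Fin n)) : RamState where
  reg i := if i = 0 then n else 0
  mem a :=
    if a < n * n then table (fun m k => (I.men m k : ℕ)) a
    else if a < 2 * (n * n) then table (fun w k => (I.women w k : ℕ)) (a - n * n)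
    else table (fun m w => if (m, w) ∈ P then 1 else 0) (a - 2 * (n * n))

/-- The state `s` holds the profile `p` as its output: the lists of `p`, one after the other, from
address `0` on. -/
def IsOutput {n : ℕ} (s : RamState) (p : Profile n) : Prop :=
  ∀ m k : Fin n, s.mem (n * m + k) = (p m k : ℕ)

end AccompliceGame

open AccompliceGame

namespace AccompliceGame

section Matching

variable {n : ℕ}

/-! ### Deferred acceptance: stability, optimality, strategyproofness -/

/-! Call a profile tame if only strategic men misreport and every man lists his current deferred
acceptance partner and the women below her in their true order. The truthful profile is tame. At a
tame profile, strategyproofness for the reported lists says that a deviation can only give the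
manipulator `m` his partner `b` or a woman whom he reports below `b`; such a woman is truly worse.
So an accomplice manipulation leaves `m` with `b` (`IsTame.partner_eq`).

Two lists of `m` that both give him `b` can be merged: the matching in which every woman takes the
better of her two partners is stable for any list whose women above `b` lie above `b` in one of the
two (`exists_stable_join`), and with man-optimality and strategyproofness such a list again gives
him `b` (`DA_update_eq`). Hence every manipulation can be replaced by a push-up that serves the
woman at least as well (`IsTame.exists_pushUp`). A push-up that keeps the partner shrinks the stable
set (`stableSet_subset_of_pushUp`) and preserves tameness; since deferred acceptance is worst for
the women among stable matchings, no woman loses. The sum of the women's ranks of their partners is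
at most `n * n` and drops at every actual step, so a dynamic stops within `n ^ 2` steps, at a tame
profile without push-up manipulation and therefore without any manipulation.

The algorithm need not search for manipulations. It pushes up single women as long as the
manipulator keeps his partner, whether or not a woman gains. Each such move increases the sum of the
reported positions of the men's partners, which is at most `n * (n - 1)`. When no move is left the
profile is an equilibrium, because a manipulation would supply a woman who can still be pushed up
(`IsTame.exists_single_pushUp`). For the running time, the algorithm is written in a small loop
language whose compilation to the machine has a polynomial cost bound read off the syntax
(`Cmd.compile_exec`); deferred acceptance is performed there by single rejections, whose order does
not affect the outcome. -/

theorem Prefers.of_not {l : PrefList n} {a b : Fin n} (h : ¬ Prefers l a b) (hab : a ≠ b) :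
    Prefers l b a :=
  lt_of_le_of_ne (not_lt.1 h) fun e => hab (l.symm.injective e.symm)

theorem Prefers.asymm {l : PrefList n} {a b : Fin n} (h : Prefers l a b) : ¬ Prefers l b a :=
  lt_asymm h

theorem Prefers.trans {l : PrefList n} {a b c : Fin n} (h : Prefers l a b) (h' : Prefers l b c) :
    Prefers l a c :=
  lt_trans h h'

theorem Prefers.ne {l : PrefList n} {a b : Fin n} (h : Prefers l a b) : a ≠ b := by
  rintro rfl
  exact lt_irrefl _ h

theorem position_DA (q p : Profile n) (m : Fin n) :
    ((p m).symm (DA q p m) : ℕ) = daState q p (n * n) m := by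
  simp [DA, daPartner]

theorem proposesTo_DA (q p : Profile n) (m : Fin n) :
    ProposesTo p (daState q p (n * n)) m (DA q p m) :=
  position_DA q p m

theorem DA_mem_stableSet (q p : Profile n) : DA q p ∈ stableSet q p := by
  rintro m w ⟨h1, h2⟩
  have h1' : ((p m).symm w : ℕ) < daState q p (n * n) m := by
    rw [← position_DA]
    exact h1
  obtain ⟨m', hm', hp⟩ := daState_inv q p (n * n) m w h1'
  have : (DA q p).symm w = m' := by
    rw [Equiv.symm_apply_eq]
    exact hm'.unique (proposesTo_DA q p m')
  rw [this] at h2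
  exact hp.asymm h2

theorem daState_mono (q p : Profile n) (m : Fin n) : Monotone fun t => daState q p t m := by
  refine monotone_nat_of_le_succ fun t => ?_
  show _ ≤ daState q p (t + 1) m
  rw [daState_succ, daRound]
  split_ifs <;> omega

/-- If a woman has rejected `m` before round `t + 1`, then the proposal she holds after round `t` is
better than `m` and is not rejected in that round. -/
theorem exists_held (q p : Profile n) (t : ℕ) (m w : Fin n)
    (h : ((p m).symm w : ℕ) < daState q p (t + 1) m) :
    ∃ b, ProposesTo p (daState q p t) b w ∧ Prefers (q w) b m ∧
      daState q p (t + 1) b = daState q p t b := by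
  have key : ∃ m', ProposesTo p (daState q p t) m' w ∧ Prefers (q w) m' m := by
    rw [daState_succ, daRound] at h
    split_ifs at h with hr
    · rcases Nat.lt_succ_iff_lt_or_eq.1 h with h | h
      · exact daState_inv q p t m w h
      · obtain ⟨w', m', h1, h2, h3⟩ := hr
        obtain rfl : w = w' := ProposesTo.unique (show ProposesTo p _ m w from h) h1
        exact ⟨m', h2, h3⟩
    · exact daState_inv q p t m w h
  obtain ⟨m', hm', hpref⟩ := key
  obtain ⟨b, hb, hbest⟩ := Finset.exists_min_image
    (Finset.univ.filter fun x => ProposesTo p (daState q p t) x w) (fun x => (q w).symm x)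
    ⟨m', by simpa using hm'⟩
  simp only [Finset.mem_filter, Finset.mem_univ, true_and] at hb hbest
  refine ⟨b, hb, lt_of_le_of_lt (hbest m' hm') hpref, ?_⟩
  have hnr : ¬ IsRejected q p (daState q p t) b := by
    rintro ⟨w', x, h1, h2, h3⟩
    obtain rfl : w = w' := hb.unique h1
    exact absurd (hbest x h2) (not_le.2 h3)
  rw [daState_succ, daRound, if_neg hnr]

/-- The blocking lemma of Gale and Sotomayor: if some man prefers `ν` to the deferred acceptance
matching, then `ν` is blocked by a pair whose man does not. -/
theorem exists_blockingPair (q p : Profile n) (ν : Matching n) (m₀ : Fin n)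
    (h₀ : Prefers (p m₀) (ν m₀) (DA q p m₀)) :
    ∃ m w, ¬ Prefers (p m) (ν m) (DA q p m) ∧ IsBlockingPair q p ν m w := by
  classical
  set μ := DA q p with hμ
  let A : Finset (Fin n) := Finset.univ.filter fun m => Prefers (p m) (ν m) (μ m)
  have hA : ∀ m, m ∈ A ↔ Prefers (p m) (ν m) (μ m) := fun m => by simp [A]
  -- If `ν` and `μ` give the men of `A` the same women, the blocking pair comes from the last round
  -- in which a man of `A` is rejected. Otherwise some woman gets a man of `A` under `ν` only, and
  -- she blocks `ν` with her partner under `μ`.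
  by_cases hsub : A.image ν ⊆ A.image μ
  · have heq : A.image ν = A.image μ := Finset.eq_of_subset_of_card_le hsub (by
      rw [Finset.card_image_of_injective _ μ.injective,
        Finset.card_image_of_injective _ ν.injective])
    have hex : ∃ t, (∃ m ∈ A, daState q p t m ≠ daState q p (n * n) m) ∧
        ∀ m ∈ A, daState q p (t + 1) m = daState q p (n * n) m := by
      by_contra hcon
      push Not at hcon
      have hall : ∀ t, ∃ m ∈ A, daState q p t m ≠ daState q p (n * n) m := by
        intro t
        induction t with
        | zero =>
          refine ⟨m₀, (hA _).2 h₀, fun h => ?_⟩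
          have h1 : ((p m₀).symm (ν m₀) : ℕ) < daState q p (n * n) m₀ := by
            rw [← position_DA]
            exact h₀
          rw [← h] at h1
          exact absurd h1 (Nat.not_lt_zero _)
        | succ t ih => exact hcon t ih
      obtain ⟨m, -, hm⟩ := hall (n * n)
      exact hm rfl
    obtain ⟨t, ⟨m₁, hm₁, hne⟩, hfin⟩ := hex
    -- `m₁` is among the last men of `A` to move on, and he then addresses `μ m₁`. Her partner `m₂`
    -- under `ν` is in `A` too, so she has already rejected him. The man `b` whom she holds just
    -- before `m₁` arrives will block `ν` with her: he is displaced later, hence outside `A`.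
    have hmem : μ m₁ ∈ A.image ν := heq ▸ Finset.mem_image_of_mem μ hm₁
    obtain ⟨m₂, hm₂, hν⟩ := Finset.mem_image.1 hmem
    have hlt : ((p m₂).symm (μ m₁) : ℕ) < daState q p (t + 1) m₂ := by
      rw [hfin m₂ hm₂, ← position_DA, ← hν]
      exact (hA m₂).1 hm₂
    obtain ⟨b, hb, hbm, hbt⟩ := exists_held q p t m₂ (μ m₁) hlt
    have hb1 : b ≠ m₁ := by
      rintro rfl
      apply hne
      rw [← hfin b hm₁, hbt]
    have hbμ : μ b ≠ μ m₁ := fun e => hb1 (μ.injective e)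
    have hbA : b ∉ A := by
      intro hbA
      have h1 : ProposesTo p (daState q p (n * n)) b (μ m₁) := by
        rw [ProposesTo, ← hfin b hbA, hbt]
        exact hb
      exact hbμ ((proposesTo_DA q p b).unique h1)
    have hbpos : Prefers (p b) (μ m₁) (μ b) := by
      refine Prefers.of_not (fun hlt' => ?_) hbμ
      -- Before the final state, `b` has not passed his final partner. After it, nobody in `A` could
      -- still move, contrary to the choice of `t`.
      by_cases htn : t ≤ n * n
      · have h1 := daState_mono q p b htn
        have h2 : ((p b).symm (μ b) : ℕ) < (p b).symm (μ m₁) := hlt'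
        rw [position_DA, hb] at h2
        exact absurd h1 (not_le.2 h2)
      · have h1 := daState_mono q p m₁ (le_of_not_ge htn)
        have h2 := daState_mono q p m₁ (show t ≤ t + 1 by omega)
        have h3 := hfin m₁ hm₁
        simp only at h1 h2
        exact hne (by omega)
    refine ⟨b, μ m₁, fun h => hbA ((hA b).2 h), ?_, ?_⟩
    · have h1 : ¬ Prefers (p b) (ν b) (μ b) := fun h => hbA ((hA b).2 h)
      exact lt_of_lt_of_le hbpos (not_lt.1 h1)
    · rwa [← hν, Equiv.symm_apply_apply, hν]
  · obtain ⟨w, hw, hw'⟩ := Finset.not_subset.1 hsub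
    obtain ⟨m', hm', rfl⟩ := Finset.mem_image.1 hw
    have hnot : μ.symm (ν m') ∉ A := fun h =>
      hw' (Finset.mem_image.2 ⟨_, h, Equiv.apply_symm_apply _ _⟩)
    have hne : μ.symm (ν m') ≠ m' := fun h => hnot (h.symm ▸ hm')
    have hp : ¬ Prefers (p (μ.symm (ν m'))) (ν (μ.symm (ν m'))) (ν m') := by
      intro h
      apply hnot
      rw [hA, Equiv.apply_symm_apply]
      exact h
    refine ⟨μ.symm (ν m'), ν m', fun h => hnot ((hA _).2 h), ?_, ?_⟩
    · exact Prefers.of_not hp fun e => hne (ν.injective e)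
    · rw [Equiv.symm_apply_apply]
      refine Prefers.of_not (fun h => ?_) hne.symm
      exact DA_mem_stableSet q p m' (ν m') ⟨(hA m').1 hm', h⟩

/-- Every man weakly prefers the deferred acceptance matching to every stable matching. -/
theorem DA_man_optimal {q p : Profile n} {ν : Matching n} (hν : ν ∈ stableSet q p) (m : Fin n) :
    ¬ Prefers (p m) (ν m) (DA q p m) := fun h =>
  let ⟨m', w, _, hb⟩ := exists_blockingPair q p ν m h
  hν m' w hb

/-- Every woman weakly prefers every stable matching to the deferred acceptance matching. -/
theorem DA_woman_pessimal {q p : Profile n} {ν : Matching n} (hν : ν ∈ stableSet q p)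
    (w : Fin n) : ¬ Prefers (q w) ((DA q p).symm w) (ν.symm w) := by
  intro h
  refine hν ((DA q p).symm w) w ⟨?_, h⟩
  have h1 := DA_man_optimal hν ((DA q p).symm w)
  rw [Equiv.apply_symm_apply] at h1
  refine Prefers.of_not h1 fun e => h.ne ?_
  rw [← e, Equiv.symm_apply_apply, e]

theorem isBlockingPair_update_of_ne {q p : Profile n} {μ : Matching n} {m m' w : Fin n}
    {l : PrefList n} (h : m' ≠ m) :
    IsBlockingPair q (Function.update p m l) μ m' w ↔ IsBlockingPair q p μ m' w := by
  rw [IsBlockingPair, IsBlockingPair, Function.update_of_ne h]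

/-- Deferred acceptance is strategyproof for the men. -/
theorem DA_strategyproof (q p : Profile n) (m : Fin n) (l : PrefList n) :
    ¬ Prefers (p m) (DA q (Function.update p m l) m) (DA q p m) := by
  intro h
  obtain ⟨m', w, h1, h2⟩ := exists_blockingPair q p _ m h
  have hne : m' ≠ m := by
    rintro rfl
    exact h1 h
  exact DA_mem_stableSet q _ m' w ((isBlockingPair_update_of_ne hne).2 h2)

/-! ### Changing the list of one man without changing his partner -/

theorem mem_stableSet_update {q p : Profile n} {m : Fin n} {l l' : PrefList n} {ν : Matching n}
    (hν : ν ∈ stableSet q (Function.update p m l))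
    (h : ∀ x, Prefers l' x (ν m) → Prefers l x (ν m)) :
    ν ∈ stableSet q (Function.update p m l') := by
  rintro m' w ⟨h1, h2⟩
  by_cases hm : m' = m
  · subst hm
    rw [Function.update_self] at h1
    refine hν m' w ⟨?_, h2⟩
    rw [Function.update_self]
    exact h w h1
  · refine hν m' w ((isBlockingPair_update_of_ne hm).2 ?_)
    rw [Function.update_of_ne hm] at h1
    exact ⟨h1, h2⟩

/-- The matching in which every woman gets the better of her partners in two matchings that are
stable for two lists of the man `m` and agree at `m`. -/
theorem exists_stable_join {q p : Profile n} {m : Fin n} {l l' : PrefList n} {μ μ' : Matching n}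
    (hμ : μ ∈ stableSet q p) (hμ' : μ' ∈ stableSet q (Function.update p m l)) (he : μ' m = μ m)
    (hl' : ∀ x, Prefers l' x (μ m) → Prefers (p m) x (μ m) ∨ Prefers l x (μ m)) :
    ∃ ν ∈ stableSet q (Function.update p m l'), ν m = μ m := by
  classical
  let f : Fin n → Fin n := fun w =>
    if Prefers (q w) (μ.symm w) (μ'.symm w) then μ.symm w else μ'.symm w
  have hf : ∀ w, f w = μ.symm w ∨ f w = μ'.symm w := fun w => by
    simp only [f]
    split_ifs <;> simp
  have hfμ : ∀ w m', Prefers (q w) m' (f w) → Prefers (q w) m' (μ.symm w) := fun w m' h => by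
    simp only [f] at h
    split_ifs at h with hc
    · exact h
    · exact lt_of_lt_of_le h (not_lt.1 hc)
  have hfμ' : ∀ w m', Prefers (q w) m' (f w) → Prefers (q w) m' (μ'.symm w) := fun w m' h => by
    simp only [f] at h
    split_ifs at h with hc
    · exact h.trans hc
    · exact h
  -- No man is chosen twice: a man chosen by `w` from `μ` and by `w'` from `μ'` differs from `m`,
  -- who has the same partner in both, so his list is the same in both profiles. He blocks `μ'` with
  -- `w` or `μ` with `w'`, depending on whom he prefers.
  have cross : ∀ w w', w ≠ w' → μ.symm w = μ'.symm w' → Prefers (q w) (μ.symm w) (μ'.symm w) →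
      ¬ Prefers (q w') (μ.symm w') (μ'.symm w') → False := by
    intro w w' hne e h1 h2
    have hw : μ (μ.symm w) = w := μ.apply_symm_apply w
    have hw' : μ' (μ.symm w) = w' := by rw [e, μ'.apply_symm_apply]
    have hm : μ.symm w ≠ m := by
      intro h
      rw [h] at hw hw'
      exact hne (by rw [← hw, ← hw', he])
    have h2' : Prefers (q w') (μ.symm w) (μ.symm w') := by
      rw [e]
      refine Prefers.of_not h2 ?_
      rw [← e]
      exact fun h => hne (μ.symm.injective h).symm
    by_cases hp : Prefers (p (μ.symm w)) w w'
    · refine hμ' (μ.symm w) w ((isBlockingPair_update_of_ne hm).2 ⟨?_, h1⟩)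
      rwa [hw']
    · refine hμ (μ.symm w) w' ⟨?_, h2'⟩
      rw [hw]
      exact Prefers.of_not hp hne
  have hinj : Function.Injective f := by
    intro w w' h
    by_contra hne
    simp only [f] at h
    split_ifs at h with h1 h2 h2
    · exact hne (μ.symm.injective h)
    · exact cross w w' hne h h1 h2
    · exact cross w' w (Ne.symm hne) h.symm h2 h1
    · exact hne (μ'.symm.injective h)
  let ν : Matching n := (Equiv.ofBijective f (Finite.injective_iff_bijective.1 hinj)).symm
  have hνs : ∀ w, ν.symm w = f w := fun w => rfl
  have hνm : ν m = μ m := by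
    rw [← Equiv.eq_symm_apply, hνs]
    rcases hf (μ m) with h | h
    · rw [h, Equiv.symm_apply_apply]
    · rw [h, ← he, Equiv.symm_apply_apply]
  have hνc : ∀ m', ν m' = μ m' ∨ ν m' = μ' m' := fun m' => by
    have h1 : f (ν m') = m' := by rw [← hνs, Equiv.symm_apply_apply]
    rcases hf (ν m') with h | h
    · left
      rw [← Equiv.symm_apply_eq, ← h, h1]
    · right
      rw [← Equiv.symm_apply_eq, ← h, h1]
  refine ⟨ν, ?_, hνm⟩
  rintro m' w ⟨h1, h2⟩
  rw [hνs] at h2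
  by_cases hm : m' = m
  · subst hm
    rw [Function.update_self, hνm] at h1
    rcases hl' w h1 with h | h
    · exact hμ m' w ⟨h, hfμ w m' h2⟩
    · refine hμ' m' w ⟨?_, hfμ' w m' h2⟩
      rw [Function.update_self, he]
      exact h
  · rw [Function.update_of_ne hm] at h1
    rcases hνc m' with h | h
    · rw [h] at h1
      exact hμ m' w ⟨h1, hfμ w m' h2⟩
    · rw [h] at h1
      exact hμ' m' w ((isBlockingPair_update_of_ne hm).2 ⟨h1, hfμ' w m' h2⟩)

/-- If `m` has the same partner `b` under two lists, then also under every list in which the women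
above `b` are above `b` in one of the two. -/
theorem DA_update_eq {q p : Profile n} {m : Fin n} {l l' : PrefList n}
    (he : DA q (Function.update p m l) m = DA q p m)
    (hl' : ∀ x, Prefers l' x (DA q p m) → Prefers (p m) x (DA q p m) ∨ Prefers l x (DA q p m)) :
    DA q (Function.update p m l') m = DA q p m := by
  by_contra hne
  obtain ⟨ν, hν, hνm⟩ :=
    exists_stable_join (DA_mem_stableSet q p) (DA_mem_stableSet q _) he hl'
  -- The join gives `m` the woman `b`, so under `l'` he does at least as well as `b` according to
  -- `l'`. Anyone strictly above `b` there is above `b` in `p m` or in `l`, and reporting `l'` would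
  -- then be a profitable deviation from that list.
  have h1 := DA_man_optimal hν m
  rw [hνm, Function.update_self] at h1
  rcases hl' _ (Prefers.of_not h1 (Ne.symm hne)) with h | h
  · exact DA_strategyproof q p m l' h
  · have h2 := DA_strategyproof q (Function.update p m l) m l'
    rw [Function.update_idem, Function.update_self, he] at h2
    exact h2 h

/-! ### Harmless push-ups -/

/-- By man-optimality, a matching stable for the new list gives `m` his partner `b` or someone below
her in that list. Down there the push-up only removed women and kept the order of the rest, so every
woman above his match in the old list is above it in the new one, and an old blocking pair stays
blocking. -/
theorem stableSet_subset_of_pushUp {q p : Profile n} {m : Fin n} {l : PrefList n}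
    (hpu : IsPushUp (p m) l (DA q p m)) (he : DA q (Function.update p m l) m = DA q p m) :
    stableSet q (Function.update p m l) ⊆ stableSet q p := by
  obtain ⟨X, hX, habove, hbelow⟩ := hpu
  rintro ν hν m' w ⟨h1, h2⟩
  by_cases hm : m' = m
  · subst hm
    have hopt := DA_man_optimal hν m'
    rw [he, Function.update_self] at hopt
    refine hν m' w ⟨?_, h2⟩
    rw [Function.update_self]
    by_cases hw : Prefers l w (DA q p m')
    · exact lt_of_lt_of_le hw (not_lt.1 hopt)
    · have hw1 : ¬ Prefers (p m') w (DA q p m') := fun h => hw ((habove w).2 (Or.inl h))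
      have hνne : ν m' ≠ DA q p m' := by
        intro e
        rw [e] at h1
        exact hw1 h1
      have hνb : Prefers l (DA q p m') (ν m') := Prefers.of_not hopt hνne
      by_cases hwb : w = DA q p m'
      · rwa [hwb]
      · exact (hbelow w (ν m') (Prefers.of_not hw hwb) hνb).2 h1
  · exact hν m' w ((isBlockingPair_update_of_ne hm).2 ⟨h1, h2⟩)

/-- The reports of a play of harmless push-ups: only strategic men misreport, and every man lists his
partner and the women below in their true order. -/
structure IsTame (I : Market n) (P : Finset (Fin n × Fin n)) (p : Profile n) : Prop where
  strategic : IsStrategyProfile I P p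
  order : ∀ m w₁ w₂, ¬ Prefers (p m) w₁ (DA I.women p m) → Prefers (p m) w₁ w₂ →
    Prefers (I.men m) w₁ w₂

theorem isTame_men (I : Market n) (P : Finset (Fin n × Fin n)) : IsTame I P I.men :=
  ⟨fun _ _ => rfl, fun _ _ _ _ h => h⟩

/-- For `m`, the part of the list from his partner down only loses women. For another man the list
is unchanged, and his new partner, coming from a matching that was stable before, is no higher in it
than his old one; so the part to be checked shrinks as well. -/
theorem IsTame.pushUp {I : Market n} {P : Finset (Fin n × Fin n)} {p : Profile n} {m w : Fin n}
    {l : PrefList n} (hp : IsTame I P p) (hmw : (m, w) ∈ P)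
    (hpu : IsPushUp (p m) l (DA I.women p m))
    (he : DA I.women (Function.update p m l) m = DA I.women p m) :
    IsTame I P (Function.update p m l) := by
  refine ⟨fun m' h => ?_, fun m' w₁ w₂ h1 h2 => ?_⟩
  · have : m' ≠ m := by
      rintro rfl
      exact h w hmw
    rw [Function.update_of_ne this]
    exact hp.strategic m' h
  · by_cases hm : m' = m
    · subst hm
      rw [Function.update_self] at h1 h2
      rw [he] at h1
      obtain ⟨X, hX, habove, hbelow⟩ := hpu
      have hb2 : Prefers l (DA I.women p m') w₂ := lt_of_le_of_lt (not_lt.1 h1) h2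
      refine hp.order m' w₁ w₂ (fun h => h1 ((habove w₁).2 (Or.inl h))) ?_
      by_cases hw : w₁ = DA I.women p m'
      · rw [hw]
        exact Prefers.of_not (fun h => hb2.asymm ((habove w₂).2 (Or.inl h))) hb2.ne.symm
      · exact (hbelow w₁ w₂ (Prefers.of_not h1 hw) hb2).1 h2
    · rw [Function.update_of_ne hm] at h1 h2
      have hs := stableSet_subset_of_pushUp hpu he (DA_mem_stableSet I.women _)
      exact hp.order m' w₁ w₂
        (fun h => h1 (lt_of_lt_of_le h (not_lt.1 (DA_man_optimal hs m')))) h2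

/-- An accomplice manipulation does not change the partner of the manipulator. -/
theorem IsTame.partner_eq {I : Market n} {P : Finset (Fin n × Fin n)} {p : Profile n}
    {m w : Fin n} {l : PrefList n} (hp : IsTame I P p) (hl : IsManipulation I p m w l) :
    DA I.women (Function.update p m l) m = DA I.women p m := by
  rcases hl.2 with h | h
  · exact h
  · by_contra hne
    exact h.asymm (hp.order m _ _ (lt_irrefl _)
      (Prefers.of_not (DA_strategyproof I.women p m l) hne))

theorem exists_prefList_of_key (key : Fin n → ℕ) (hkey : Function.Injective key) :
    ∃ l : PrefList n, ∀ x y, Prefers l x y ↔ key x < key y := by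
  have hmono : StrictMono (key ∘ Tuple.sort key) :=
    (Tuple.monotone_sort key).strictMono_of_injective
      (hkey.comp (Tuple.sort key).injective)
  refine ⟨Tuple.sort key, fun x y => ?_⟩
  have := hmono.lt_iff_lt (a := (Tuple.sort key).symm x) (b := (Tuple.sort key).symm y)
  simpa [Prefers] using this.symm

/-- If there is an accomplice manipulation, then there is one that is a push-up. -/
theorem IsTame.exists_pushUp {I : Market n} {P : Finset (Fin n × Fin n)} {p : Profile n}
    {m w : Fin n} {l : PrefList n} (hp : IsTame I P p) (hl : IsManipulation I p m w l) :
    ∃ l', IsPushUp (p m) l' (DA I.women p m) ∧ IsManipulation I p m w l' := by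
  classical
  have he := hp.partner_eq hl
  set b := DA I.women p m with hb
  let U : Fin n → Prop := fun x => Prefers (p m) x b ∨ Prefers l x b
  have hUb : ¬ U b := fun h => h.elim (lt_irrefl _) (lt_irrefl _)
  -- Positions are less than `n`, so adding `n` puts everyone outside `U` behind all of `U`; within
  -- each group the order of `p m` is kept.
  obtain ⟨l', hl'⟩ := exists_prefList_of_key
    (fun x => if U x then ((p m).symm x : ℕ) else n + (p m).symm x) (by
      intro x y h
      have hx := ((p m).symm x).2
      have hy := ((p m).symm y).2
      apply (p m).symm.injective
      apply Fin.ext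
      simp only at h
      split_ifs at h <;> omega)
  have habove : ∀ x, Prefers l' x b ↔ U x := by
    intro x
    rw [hl', if_neg hUb]
    have hx := ((p m).symm x).2
    by_cases h : U x
    · rw [if_pos h]
      exact ⟨fun _ => h, fun _ => by omega⟩
    · rw [if_neg h]
      refine ⟨fun h' => absurd (Or.inl ?_) h, fun h' => absurd h' h⟩
      show ((p m).symm x) < (p m).symm b
      exact Fin.lt_def.2 (by omega)
  have he' : DA I.women (Function.update p m l') m = b := DA_update_eq he fun x hx => (habove x).1 hx
  refine ⟨l', ⟨Finset.univ.filter fun x => Prefers l x b,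
    fun h => lt_irrefl _ (Finset.mem_filter.1 h).2, ?_, ?_⟩, ?_, Or.inl he'⟩
  · intro x
    rw [habove]
    simp [U]
  · intro w₁ w₂ h1 h2
    have hU1 : ¬ U w₁ := fun h => h1.asymm ((habove w₁).2 h)
    have hU2 : ¬ U w₂ := fun h => h2.asymm ((habove w₂).2 h)
    rw [hl', if_neg hU1, if_neg hU2]
    simp [Prefers]
  -- `l'` has at least the women of `l` above `b`, so its outcome is also stable for `l`; there it
  -- is no worse for `w` than the deferred acceptance outcome, which already improves on her
  -- partner.
  · have hs : DA I.women (Function.update p m l') ∈ stableSet I.women (Function.update p m l) := by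
      refine mem_stableSet_update (DA_mem_stableSet I.women _) fun x hx => ?_
      rw [he'] at hx ⊢
      exact (habove x).2 (Or.inr hx)
    exact lt_of_le_of_lt (not_lt.1 (DA_woman_pessimal hs w)) hl.1

/-- If there is an accomplice manipulation, then some woman below the partner of the manipulator can
be pushed up without changing his partner. -/
theorem IsTame.exists_single_pushUp {I : Market n} {P : Finset (Fin n × Fin n)} {p : Profile n}
    {m w : Fin n} {l : PrefList n} (hp : IsTame I P p) (hl : IsManipulation I p m w l) :
    ∃ x, Prefers (p m) (DA I.women p m) x ∧ ∀ l' : PrefList n,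
      (∀ y, Prefers l' y (DA I.women p m) → Prefers (p m) y (DA I.women p m) ∨ y = x) →
        DA I.women (Function.update p m l') m = DA I.women p m := by
  have he := hp.partner_eq hl
  -- If `l` put nobody new above the partner, the old outcome would remain stable for `l`, and `w`,
  -- who gets her worst stable partner, could not gain.
  have hx : ∃ x, Prefers l x (DA I.women p m) ∧ ¬ Prefers (p m) x (DA I.women p m) := by
    by_contra hcon
    push Not at hcon
    have hs : DA I.women p ∈ stableSet I.women (Function.update p m l) := by
      refine mem_stableSet_update (l := p m) ?_ fun x hx => hcon x hx
      rw [Function.update_eq_self]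
      exact DA_mem_stableSet I.women p
    exact DA_woman_pessimal hs w hl.1
  obtain ⟨x, hx1, hx2⟩ := hx
  refine ⟨x, Prefers.of_not hx2 hx1.ne, fun l' hl' => DA_update_eq he fun y hy => ?_⟩
  rcases hl' y hy with h | rfl
  · exact Or.inl h
  · exact Or.inr hx1

/-! ### Push-up dynamics -/

theorem IsPushUpStep.spec {I : Market n} {P : Finset (Fin n × Fin n)} {p p' : Profile n}
    (hp : IsTame I P p) (h : IsPushUpStep I P p p') :
    IsTame I P p' ∧ stableSet I.women p' ⊆ stableSet I.women p ∧
      (∀ w, WeaklyPrefers (I.women w) ((DA I.women p').symm w) ((DA I.women p).symm w)) ∧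
      ∃ w, Prefers (I.women w) ((DA I.women p').symm w) ((DA I.women p).symm w) := by
  obtain ⟨m, w, l, hmw, hman, hpu, rfl⟩ := h
  have he := hp.partner_eq hman
  have hs := stableSet_subset_of_pushUp hpu he
  refine ⟨hp.pushUp hmw hpu he, hs, fun w' => ?_, w, hman.1⟩
  by_cases hw : (DA I.women (Function.update p m l)).symm w' = (DA I.women p).symm w'
  · exact Or.inl hw
  · exact Or.inr (Prefers.of_not
      (DA_woman_pessimal (hs (DA_mem_stableSet I.women _)) w') (Ne.symm hw))

theorem pushUpDynamic_spec {I : Market n} {P : Finset (Fin n × Fin n)} {p : ℕ → Profile n}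
    (h : IsPushUpDynamic I P p) :
    (∀ t, stableSet I.women (p (t + 1)) ⊆ stableSet I.women (p t)) ∧
    (∀ t, p (t + 1) ≠ p t →
      (∀ w, WeaklyPrefers (I.women w)
        ((DA I.women (p (t + 1))).symm w) ((DA I.women (p t)).symm w)) ∧
      ∃ w, Prefers (I.women w)
        ((DA I.women (p (t + 1))).symm w) ((DA I.women (p t)).symm w)) ∧
    ∃ t ≤ n ^ 2, (∀ s ≥ t, p s = p t) ∧ IsNashEquilibrium I P (p t) := by
  obtain ⟨h0, hstep⟩ := h
  have htame : ∀ t, IsTame I P (p t) := by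
    intro t
    induction t with
    | zero => exact h0 ▸ isTame_men I P
    | succ t ih =>
      rcases hstep t with h | ⟨-, h⟩
      · exact (h.spec ih).1
      · rwa [h]
  have himp : ∀ t, p (t + 1) ≠ p t → IsPushUpStep I P (p t) (p (t + 1)) := fun t hne =>
    (hstep t).resolve_right fun h => hne h.2
  refine ⟨fun t => ?_, fun t hne => ((himp t hne).spec (htame t)).2.2, ?_⟩
  · rcases hstep t with h | ⟨-, h⟩
    · exact (h.spec (htame t)).2.1
    · rw [h]
  let Ψ : Profile n → ℕ := fun p => ∑ w, ((I.women w).symm ((DA I.women p).symm w) : ℕ)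
  have hex : ∃ t ≤ n ^ 2, p (t + 1) = p t := by
    by_contra hcon
    push Not at hcon
    have hdec : ∀ t ≤ n ^ 2 + 1, Ψ (p t) + t ≤ Ψ (p 0) := by
      intro t
      induction t with
      | zero => simp
      | succ t ih =>
        intro ht
        have h1 := ih (by omega)
        obtain ⟨hw, w, hw'⟩ := ((himp t (hcon t (by omega))).spec (htame t)).2.2
        have : Ψ (p (t + 1)) < Ψ (p t) := by
          refine Finset.sum_lt_sum (fun w _ => ?_) ⟨w, Finset.mem_univ _, hw'⟩
          rcases hw w with h | h
          · rw [h]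
          · exact le_of_lt h
        omega
    have h1 := hdec _ le_rfl
    have h2 : Ψ (p 0) ≤ ∑ _w : Fin n, n := Finset.sum_le_sum fun w _ => le_of_lt (Fin.is_lt _)
    simp only [Finset.sum_const, Finset.card_univ, Fintype.card_fin, smul_eq_mul] at h2
    rw [pow_two] at h1
    omega
  obtain ⟨t, ht, hfix⟩ := hex
  -- A genuine step strictly improves some woman, so it cannot return to the same profile; standing
  -- still means that no push-up is available.
  have hno : ¬ ∃ p', IsPushUpStep I P (p t) p' := by
    rcases hstep t with h | ⟨h, -⟩
    · obtain ⟨w, hw⟩ := (h.spec (htame t)).2.2.2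
      rw [hfix] at hw
      exact absurd hw (lt_irrefl _)
    · exact h
  refine ⟨t, ht, fun s hs => ?_, (htame t).strategic, fun m w hmw l hl => ?_⟩
  · induction s, hs using Nat.le_induction with
    | base => rfl
    | succ s _ ih =>
      rcases hstep s with h | ⟨-, h⟩
      · rw [ih] at h
        exact absurd ⟨_, h⟩ hno
      · rw [h, ih]
  · obtain ⟨l', h1, h2⟩ := (htame t).exists_pushUp hl
    exact hno ⟨_, m, w, l', hmw, h2, h1, rfl⟩

end Matching

/-! ### A structured language and its compilation to random access machines -/

/-- The data of a structured command: variables, and `n × n` arrays. -/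
structure Store where
  var : ℕ → ℕ
  arr : ℕ → ℕ → ℕ → ℕ

/-- Expressions; `read a e f` is the entry `(e, f)` of the array `a`. -/
inductive Expr : Type
  | const (c : ℕ) : Expr
  | var (v : ℕ) : Expr
  | add (e f : Expr) : Expr
  | sub (e f : Expr) : Expr
  | read (a : ℕ) (e f : Expr) : Expr

/-- The value of an expression; entries outside of an array have the value `0`. -/
def Expr.eval (n : ℕ) (S : Store) : Expr → ℕ
  | const c => c
  | var v => S.var v
  | add e f => e.eval n S + f.eval n S
  | sub e f => e.eval n S - f.eval n S
  | read a e f =>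
    if e.eval n S < n ∧ f.eval n S < n then S.arr a (e.eval n S) (f.eval n S) else 0

/-- Structured commands; `each v c` performs `c` for the values `0, …, n - 1` of `v`. -/
inductive Cmd : Type
  | skip : Cmd
  | set (v : ℕ) (e : Expr) : Cmd
  | write (a : ℕ) (i j e : Expr) : Cmd
  | seq (c₁ c₂ : Cmd) : Cmd
  | ite (e : Expr) (c₁ c₂ : Cmd) : Cmd
  | each (v : ℕ) (c : Cmd) : Cmd

def Store.set (S : Store) (v x : ℕ) : Store := ⟨Function.update S.var v x, S.arr⟩

def Store.write (S : Store) (a i j x : ℕ) : Store :=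
  ⟨S.var, fun a' i' j' => if a' = a ∧ i' = i ∧ j' = j then x else S.arr a' i' j'⟩

/-- The effect of a command; writing outside of an array has no effect. -/
def Cmd.run (n : ℕ) : Cmd → Store → Store
  | skip, S => S
  | set v e, S => S.set v (e.eval n S)
  | write a i j e, S =>
    if i.eval n S < n ∧ j.eval n S < n then
      S.write a (i.eval n S) (j.eval n S) (e.eval n S)
    else S
  | seq c₁ c₂, S => c₂.run n (c₁.run n S)
  | ite e c₁ c₂, S => if e.eval n S ≠ 0 then c₁.run n S else c₂.run n S
  | each v c, S => (List.range n).foldl (fun S i => c.run n (S.set v i)) S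

/-- `reg d := reg d + a * n` -/
def Program.addSize (d : ℕ) : ℕ → Program
  | 0 => skip
  | a + 1 => seq (addSize d a) (add d d 0)

/-- From `i` and `j` in the temporary registers `d` and `d + 1`, compute the address of the entry
`(i, j)` of the array `a`, in the temporary register `d`. -/
def Program.address (d a : ℕ) : Program :=
  seq (addSize (2 * d + 2) a) <| seq (const (2 * d + 8) 1) <| seq (const (2 * d + 6) 0) <|
    seq (add (2 * d + 6) (2 * d + 6) 0) <|
    seq (loop (2 * d + 6) (seq (add (2 * d + 4) (2 * d + 4) (2 * d + 2))
      (sub (2 * d + 6) (2 * d + 6) (2 * d + 8)))) <|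
    add (2 * d + 2) (2 * d + 4) (2 * d + 6)

/-- Compute an expression in the temporary register `d`. The variable `v` is the register `2 * v + 1`,
and the temporary register `d` is the register `2 * d + 2`. -/
def Expr.compile : Expr → ℕ → Program
  | const c, d => .const (2 * d + 2) c
  | var v, d => .seq (.const (2 * d + 2) 0) (.add (2 * d + 2) (2 * d + 2) (2 * v + 1))
  | add e f, d =>
    .seq (e.compile d) (.seq (f.compile (d + 1)) (.add (2 * d + 2) (2 * d + 2) (2 * d + 4)))
  | sub e f, d =>
    .seq (e.compile d) (.seq (f.compile (d + 1)) (.sub (2 * d + 2) (2 * d + 2) (2 * d + 4)))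
  | read a e f, d =>
    .seq (e.compile d) <| .seq (f.compile (d + 1)) <| .seq (.sub (2 * d + 6) 0 (2 * d + 2)) <|
      .seq (.sub (2 * d + 8) 0 (2 * d + 4)) <|
      .ite (2 * d + 6) (.ite (2 * d + 8)
        (.seq (.address d a) (.load (2 * d + 2) (2 * d + 2)))
        (.const (2 * d + 2) 0)) (.const (2 * d + 2) 0)

/-- In a loop the temporary register `d` counts down from `n`, and the loop variable is recomputed
as `n` minus the counter, so it runs upwards. The body uses temporaries from `d + 1` on and cannot
disturb the counter. -/
def Cmd.compile : Cmd → ℕ → Program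
  | skip, _ => .skip
  | set v e, d =>
    .seq (e.compile d) (.seq (.const (2 * d + 4) 0) (.add (2 * v + 1) (2 * d + 2) (2 * d + 4)))
  | write a i j e, d =>
    .seq (e.compile d) <| .seq (i.compile (d + 1)) <| .seq (j.compile (d + 2)) <|
      .seq (.sub (2 * (d + 1) + 6) 0 (2 * (d + 1) + 2)) <|
      .seq (.sub (2 * (d + 1) + 8) 0 (2 * (d + 1) + 4)) <|
      .ite (2 * (d + 1) + 6) (.ite (2 * (d + 1) + 8)
        (.seq (.address (d + 1) a) (.store (2 * (d + 1) + 2) (2 * d + 2))) .skip) .skip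
  | seq c₁ c₂, d => .seq (c₁.compile d) (c₂.compile d)
  | ite e c₁ c₂, d => .seq (e.compile d) (.ite (2 * d + 2) (c₁.compile d) (c₂.compile d))
  | each v c, d =>
    .seq (.const (2 * d + 2) 0) <| .seq (.add (2 * d + 2) (2 * d + 2) 0) <|
      .loop (2 * d + 2) <| .seq (.sub (2 * v + 1) 0 (2 * d + 2)) <| .seq (c.compile (d + 1)) <|
        .seq (.const (2 * d + 4) 1) (.sub (2 * d + 2) (2 * d + 2) (2 * d + 4))

open Polynomial in
noncomputable def Expr.cost : Expr → ℕ[X]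
  | const _ => 1
  | var _ => 2
  | add e f => e.cost + f.cost + 1
  | sub e f => e.cost + f.cost + 1
  | read a e f => e.cost + f.cost + (a : ℕ[X]) + 3 * X + 12

-- An upper bound in the size `n`; a conditional is charged for both branches. Each round of a loop
-- costs four steps beyond its body (one test, setting the variable, two for decrementing the
-- counter), and the remaining three are the initialization and the last test.
open Polynomial in
noncomputable def Cmd.cost : Cmd → ℕ[X]
  | skip => 1
  | set _ e => e.cost + 2
  | write a i j e => e.cost + i.cost + j.cost + (a : ℕ[X]) + 3 * X + 12
  | seq c₁ c₂ => c₁.cost + c₂.cost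
  | ite e c₁ c₂ => e.cost + c₁.cost + c₂.cost + 1
  | each _ c => X * (c.cost + 4) + 3

/-! ### Correctness and running time of the compiled code -/

/-- The machine state `s` represents the store `S`. -/
structure Represents (n : ℕ) (S : Store) (s : RamState) : Prop where
  size : s.reg 0 = n
  var : ∀ v, s.reg (2 * v + 1) = S.var v
  arr : ∀ a i j, i < n → j < n → s.mem ((a * n + i) * n + j) = S.arr a i j

/-- `s'` arises from `s` by changes of temporary registers from `d` on only. -/
structure TempEq (d : ℕ) (s s' : RamState) : Prop where
  mem : s'.mem = s.mem
  reg : ∀ k, k % 2 = 1 ∨ k < 2 * d + 2 → s'.reg k = s.reg k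

theorem TempEq.trans {d d' : ℕ} {s s' s'' : RamState} (h : TempEq d s s') (h' : TempEq d' s' s'')
    (hd : d ≤ d') : TempEq d s s'' :=
  ⟨h'.mem.trans h.mem, fun k hk => (h'.reg k (by omega)).trans (h.reg k hk)⟩

theorem Represents.of_tempEq {n d : ℕ} {S : Store} {s s' : RamState} (h : Represents n S s)
    (h' : TempEq d s s') : Represents n S s' :=
  ⟨(h'.reg 0 (by omega)).trans h.size, fun v => (h'.reg _ (by omega)).trans (h.var v),
    fun a i j hi hj => by rw [h'.mem]; exact h.arr a i j hi hj⟩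

theorem tempEq_update {d k : ℕ} (s : RamState) (x : ℕ) (hk : k % 2 = 0) (hd : 2 * d + 2 ≤ k) :
    TempEq d s ⟨Function.update s.reg k x, s.mem⟩ :=
  ⟨rfl, fun k' h => Function.update_of_ne (by omega) _ _⟩

theorem Program.addSize_exec (d a : ℕ) (hd : d ≠ 0) (s : RamState) :
    Exec (addSize d a) s (a + 1) ⟨Function.update s.reg d (s.reg d + a * s.reg 0), s.mem⟩ := by
  induction a with
  | zero => simpa [addSize] using Exec.skip s
  | succ a ih =>
    have h2 := Exec.add d d 0 ⟨Function.update s.reg d (s.reg d + a * s.reg 0), s.mem⟩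
    have h3 := Exec.seq ih h2
    simp only [Function.update_self, Function.update_idem, Function.update_of_ne hd.symm] at h3
    rw [add_assoc (s.reg d), ← Nat.succ_mul] at h3
    exact h3

/-- Multiplication by repeated addition, linear in the multiplier `k`, which is enough since only
multiples of numbers by `n` are needed for addresses. -/
theorem Program.multiply_exec {x y c o : ℕ} (hxy : x ≠ y) (hxc : x ≠ c) (hyc : y ≠ c)
    (hyo : y ≠ o) (hco : c ≠ o) (k : ℕ) (s : RamState) (hc : s.reg c = k) (ho : s.reg o = 1) :
    Exec (loop c (seq (add y y x) (sub c c o))) s (3 * k + 1)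
      ⟨Function.update (Function.update s.reg y (s.reg y + k * s.reg x)) c 0, s.mem⟩ := by
  induction k generalizing s with
  | zero =>
    have := Exec.loop_done (c := seq (add y y x) (sub c c o)) hc
    have e : Function.update (Function.update s.reg y (s.reg y + 0 * s.reg x)) c 0 = s.reg := by
      rw [zero_mul, add_zero, Function.update_eq_self, ← hc, Function.update_eq_self]
    rw [e]
    exact this
  | succ k ih =>
    have hb := Exec.seq (Exec.add y y x s) (Exec.sub c c o _)
    have h1 := ih ⟨Function.update (Function.update s.reg y (s.reg y + s.reg x)) c
      (Function.update s.reg y (s.reg y + s.reg x) c -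
        Function.update s.reg y (s.reg y + s.reg x) o), s.mem⟩
      (by simp [hyc.symm, hyo.symm, hc, ho]) (by simp [hco.symm, hyo.symm, ho])
    have h2 := Exec.loop_again (by omega) hb h1
    convert h2 using 1
    · omega
    · congr 1
      funext r
      by_cases hr : r = c
      · subst hr; simp
      · by_cases hr' : r = y
        · subst hr'
          simp [hr, hxc, hxy]
          ring
        · simp [hr, hr']

theorem Program.address_exec {n d a i j : ℕ} {s : RamState} (h0 : s.reg 0 = n)
    (hi : s.reg (2 * d + 2) = i) (hj : s.reg (2 * d + 4) = j) :
    ∃ s', Exec (address d a) s (a + 3 * n + 6) s' ∧ s'.reg (2 * d + 2) = (a * n + i) * n + j ∧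
      TempEq d s s' := by
  have h1 := addSize_exec (2 * d + 2) a (by omega) s
  have h2 := Exec.seq (Exec.const (2 * d + 8) 1
    ⟨Function.update s.reg (2 * d + 2) (s.reg (2 * d + 2) + a * s.reg 0), s.mem⟩)
    (Exec.seq (Exec.const (2 * d + 6) 0 _) (Exec.seq (Exec.add (2 * d + 6) (2 * d + 6) 0 _)
      (Exec.seq (multiply_exec (x := 2 * d + 2) (y := 2 * d + 4) (c := 2 * d + 6)
        (o := 2 * d + 8) (by omega) (by omega) (by omega) (by omega) (by omega) n _
        (by simp [h0]) (by simp)) (Exec.add (2 * d + 2) (2 * d + 4) (2 * d + 6) _))))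
  have h3 := Exec.seq h1 h2
  rw [show a + 1 + (1 + (1 + (1 + (3 * n + 1 + 1)))) = a + 3 * n + 6 by omega] at h3
  refine ⟨_, h3, ?_, ?_⟩
  · simp [h0, hi, hj]
    ring
  · refine ⟨rfl, fun k hk => ?_⟩
    have e1 : k ≠ 2 * d + 2 := by omega
    have e2 : k ≠ 2 * d + 4 := by omega
    have e3 : k ≠ 2 * d + 6 := by omega
    have e4 : k ≠ 2 * d + 8 := by omega
    simp [e1, e2, e3, e4]

theorem Expr.compile_exec {n : ℕ} {S : Store} (e : Expr) (d : ℕ) (s : RamState)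
    (h : Represents n S s) :
    ∃ t s', Exec (e.compile d) s t s' ∧ t ≤ e.cost.eval n ∧ s'.reg (2 * d + 2) = e.eval n S ∧
      TempEq d s s' := by
  induction e generalizing d s with
  | const c =>
    refine ⟨_, _, Exec.const _ _ s, ?_, ?_, tempEq_update _ _ (by omega) le_rfl⟩
    · simp [cost]
    · simp [eval]
  | var v =>
    refine ⟨_, _, Exec.seq (Exec.const _ _ s) (Exec.add _ _ _ _), ?_, ?_, ?_⟩
    · simp [cost]
    · have : 2 * v + 1 ≠ 2 * d + 2 := by omega
      simp only [eval, Function.update_self, zero_add]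
      rw [Function.update_of_ne this, h.var]
    · exact (tempEq_update _ _ (by omega) le_rfl).trans (tempEq_update _ _ (by omega) le_rfl) le_rfl
  | add e f ihe ihf =>
    obtain ⟨t1, s1, x1, c1, r1, q1⟩ := ihe d s h
    obtain ⟨t2, s2, x2, c2, r2, q2⟩ := ihf (d + 1) s1 (h.of_tempEq q1)
    refine ⟨_, _, Exec.seq x1 (Exec.seq x2 (Exec.add _ _ _ _)), ?_, ?_, ?_⟩
    · simp [cost]
      omega
    · have : s2.reg (2 * d + 4) = f.eval n S := r2
      simp [eval, this, q2.reg (2 * d + 2) (by omega), r1]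
    · exact (q1.trans q2 (by omega)).trans (tempEq_update _ _ (by omega) le_rfl) le_rfl
  | sub e f ihe ihf =>
    obtain ⟨t1, s1, x1, c1, r1, q1⟩ := ihe d s h
    obtain ⟨t2, s2, x2, c2, r2, q2⟩ := ihf (d + 1) s1 (h.of_tempEq q1)
    refine ⟨_, _, Exec.seq x1 (Exec.seq x2 (Exec.sub _ _ _ _)), ?_, ?_, ?_⟩
    · simp [cost]
      omega
    · have : s2.reg (2 * d + 4) = f.eval n S := r2
      simp [eval, this, q2.reg (2 * d + 2) (by omega), r1]
    · exact (q1.trans q2 (by omega)).trans (tempEq_update _ _ (by omega) le_rfl) le_rfl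
  | read a e f ihe ihf =>
    obtain ⟨t1, s1, x1, c1, r1, q1⟩ := ihe d s h
    obtain ⟨t2, s2, x2, c2, r2, q2⟩ := ihf (d + 1) s1 (h.of_tempEq q1)
    have x3 := Exec.sub (2 * d + 6) 0 (2 * d + 2) s2
    have x4 := Exec.sub (2 * d + 8) 0 (2 * d + 4)
      ⟨Function.update s2.reg (2 * d + 6) (s2.reg 0 - s2.reg (2 * d + 2)), s2.mem⟩
    generalize hs4 : (RamState.mk (Function.update _ (2 * d + 8) _) _) = s4 at x4
    have q12 : TempEq d s s2 := q1.trans q2 (by omega)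
    have q4 : TempEq d s s4 := by
      rw [← hs4]
      exact (q12.trans (tempEq_update _ _ (by omega) (by omega)) le_rfl).trans
        (tempEq_update _ _ (by omega) (by omega)) le_rfl
    have h4 := h.of_tempEq q4
    have r1' : s2.reg (2 * d + 2) = e.eval n S := by rw [q2.reg (2 * d + 2) (by omega), r1]
    have r2' : s2.reg (2 * d + 4) = f.eval n S := r2
    have r0 : s2.reg 0 = n := (h.of_tempEq q12).size
    have v1 : s4.reg (2 * d + 2) = e.eval n S := by simp [← hs4, r1']
    have v2 : s4.reg (2 * d + 4) = f.eval n S := by simp [← hs4, r2']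
    -- By truncated subtraction these two registers are nonzero exactly when the indices are in
    -- range, so they serve as the bounds checks.
    have v3 : s4.reg (2 * d + 6) = n - e.eval n S := by simp [← hs4, r1', r0]
    have v4 : s4.reg (2 * d + 8) = n - f.eval n S := by simp [← hs4, r2', r0]
    by_cases b1 : e.eval n S < n
    · by_cases b2 : f.eval n S < n
      · obtain ⟨s5, x5, r5, q5⟩ := Program.address_exec (a := a) h4.size v1 v2
        refine ⟨_, _, Exec.seq x1 <| Exec.seq x2 <| Exec.seq x3 <| Exec.seq x4 <|
          Exec.ite_true (by omega) <| Exec.ite_true (by omega) <| Exec.seq x5 (Exec.load _ _ _),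
          ?_, ?_, ?_⟩
        · simp [cost]
          omega
        · simp [eval, b1, b2, r5, q5.mem, h4.arr _ _ _ b1 b2]
        · exact (q4.trans q5 le_rfl).trans (tempEq_update _ _ (by omega) le_rfl) le_rfl
      · refine ⟨_, _, Exec.seq x1 <| Exec.seq x2 <| Exec.seq x3 <| Exec.seq x4 <|
          Exec.ite_true (by omega) <| Exec.ite_false (by omega) (Exec.const _ _ _),
          ?_, ?_, ?_⟩
        · simp [cost]
          omega
        · simp [eval, b2]
        · exact q4.trans (tempEq_update _ _ (by omega) le_rfl) le_rfl
    · refine ⟨_, _, Exec.seq x1 <| Exec.seq x2 <| Exec.seq x3 <| Exec.seq x4 <|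
        Exec.ite_false (by omega) (Exec.const _ _ _), ?_, ?_, ?_⟩
      · simp [cost]
        omega
      · simp [eval, b1]
      · exact q4.trans (tempEq_update _ _ (by omega) le_rfl) le_rfl

/-- `j` and `i` are the two lowest digits of the address in base `n`, so distinct entries, also of
different arrays, never share a cell. -/
theorem arrayAddress_inj {n a i j a' i' j' : ℕ} (hi : i < n) (hj : j < n) (hi' : i' < n)
    (hj' : j' < n) (h : (a * n + i) * n + j = (a' * n + i') * n + j') :
    a = a' ∧ i = i' ∧ j = j' := by
  have aux : ∀ x y x' y' : ℕ, y < n → y' < n → x * n + y = x' * n + y' → x = x' ∧ y = y' := by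
    intro x y x' y' hy hy' e
    have hn : 0 < n := by omega
    have h1 : (x * n + y) / n = x := by
      rw [mul_comm, Nat.mul_add_div hn, Nat.div_eq_of_lt hy, add_zero]
    have h2 : (x' * n + y') / n = x' := by
      rw [mul_comm, Nat.mul_add_div hn, Nat.div_eq_of_lt hy', add_zero]
    have hx : x = x' := by rw [← h1, e, h2]
    subst hx
    exact ⟨rfl, by omega⟩
  obtain ⟨h1, h2⟩ := aux _ _ _ _ hj hj' h
  obtain ⟨h3, h4⟩ := aux _ _ _ _ hi hi' h1
  exact ⟨h3, h4, h2⟩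

theorem Represents.set {n : ℕ} {S : Store} {s : RamState} (h : Represents n S s) (v x : ℕ) :
    Represents n (S.set v x) ⟨Function.update s.reg (2 * v + 1) x, s.mem⟩ := by
  refine ⟨?_, fun v' => ?_, fun a i j hi hj => h.arr a i j hi hj⟩
  · simp [h.size]
  · by_cases hv : v' = v
    · subst hv; simp [Store.set]
    · have : 2 * v' + 1 ≠ 2 * v + 1 := by omega
      simp [Store.set, hv, h.var]

theorem Represents.write {n : ℕ} {S : Store} {s : RamState} (h : Represents n S s) {a i j x : ℕ}
    (hi : i < n) (hj : j < n) :
    Represents n (S.write a i j x) ⟨s.reg, Function.update s.mem ((a * n + i) * n + j) x⟩ := by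
  refine ⟨h.size, h.var, fun a' i' j' hi' hj' => ?_⟩
  by_cases he : a' = a ∧ i' = i ∧ j' = j
  · obtain ⟨rfl, rfl, rfl⟩ := he
    simp [Store.write]
  · simp only [Store.write, if_neg he]
    rw [Function.update_of_ne fun e => he (arrayAddress_inj hi' hj' hi hj e)]
    exact h.arr a' i' j' hi' hj'

/-- The compiled command has the effect of the command, in polynomial time, and keeps the temporary
registers below `d`. -/
theorem Cmd.compile_exec {n : ℕ} (c : Cmd) (d : ℕ) (S : Store) (s : RamState)
    (h : Represents n S s) :
    ∃ t s', Exec (c.compile d) s t s' ∧ t ≤ c.cost.eval n ∧ Represents n (c.run n S) s' ∧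
      ∀ k < d, s'.reg (2 * k + 2) = s.reg (2 * k + 2) := by
  induction c generalizing d S s with
  | skip => exact ⟨_, _, Exec.skip s, by simp [cost], h, fun _ _ => rfl⟩
  | set v e =>
    obtain ⟨t1, s1, x1, c1, r1, q1⟩ := e.compile_exec d s h
    refine ⟨_, _, Exec.seq x1 (Exec.seq (Exec.const _ _ _) (Exec.add _ _ _ _)), ?_, ?_, ?_⟩
    · simp [cost]
      omega
    · have q2 : TempEq d s1 ⟨Function.update s1.reg (2 * d + 4) 0, s1.mem⟩ :=
        tempEq_update _ _ (by omega) (by omega)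
      have := ((h.of_tempEq q1).of_tempEq q2).set v (e.eval n S)
      simpa [run, r1] using this
    · intro k hk
      have e1 : k ≠ d := by omega
      have e2 : 2 * k + 2 ≠ 2 * d + 4 := by omega
      have e3 : 2 * k + 2 ≠ 2 * v + 1 := by omega
      simp only [Function.update_of_ne e2, Function.update_of_ne e3]
      exact q1.reg _ (by omega)
  | write a i j e =>
    obtain ⟨t0, s0, x0, c0, r0, q0⟩ := e.compile_exec d s h
    obtain ⟨t1, s1, x1, c1, r1, q1⟩ := i.compile_exec (d + 1) s0 (h.of_tempEq q0)
    obtain ⟨t2, s2, x2, c2, r2, q2⟩ :=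
      j.compile_exec (d + 2) s1 ((h.of_tempEq q0).of_tempEq q1)
    have x3 := Exec.sub (2 * (d + 1) + 6) 0 (2 * (d + 1) + 2) s2
    have x4 := Exec.sub (2 * (d + 1) + 8) 0 (2 * (d + 1) + 4)
      ⟨Function.update s2.reg (2 * (d + 1) + 6) (s2.reg 0 - s2.reg (2 * (d + 1) + 2)), s2.mem⟩
    generalize hs4 : (RamState.mk (Function.update _ (2 * (d + 1) + 8) _) _) = s4 at x4
    have q02 : TempEq d s s2 := (q0.trans q1 (by omega)).trans q2 (by omega)
    have q4' : TempEq (d + 1) s2 s4 := by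
      rw [← hs4]
      exact (tempEq_update _ _ (by omega) (by omega)).trans
        (tempEq_update _ _ (by omega) (by omega)) le_rfl
    have q4 : TempEq d s s4 := q02.trans q4' (by omega)
    have h4 := h.of_tempEq q4
    have r1' : s2.reg (2 * (d + 1) + 2) = i.eval n S := by rw [q2.reg _ (by omega), r1]
    have r2' : s2.reg (2 * (d + 1) + 4) = j.eval n S := r2
    have rn : s2.reg 0 = n := (h.of_tempEq q02).size
    have v0 : s4.reg (2 * d + 2) = e.eval n S := by
      rw [q4'.reg _ (by omega), q2.reg _ (by omega), q1.reg _ (by omega), r0]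
    have v1 : s4.reg (2 * (d + 1) + 2) = i.eval n S := by simp [← hs4, r1']
    have v2 : s4.reg (2 * (d + 1) + 4) = j.eval n S := by simp [← hs4, r2']
    have v3 : s4.reg (2 * (d + 1) + 6) = n - i.eval n S := by simp [← hs4, r1', rn]
    have v4 : s4.reg (2 * (d + 1) + 8) = n - j.eval n S := by simp [← hs4, r2', rn]
    by_cases b1 : i.eval n S < n
    · by_cases b2 : j.eval n S < n
      · obtain ⟨s5, x5, r5, q5⟩ := Program.address_exec (a := a) h4.size v1 v2
        refine ⟨_, _, Exec.seq x0 <| Exec.seq x1 <| Exec.seq x2 <| Exec.seq x3 <| Exec.seq x4 <|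
          Exec.ite_true (by omega) <| Exec.ite_true (by omega) <| Exec.seq x5 (Exec.store _ _ _),
          ?_, ?_, ?_⟩
        · simp [cost]
          omega
        · have := (h4.of_tempEq q5).write (a := a) (x := e.eval n S) b1 b2
          rw [r5, q5.reg (2 * d + 2) (by omega), v0]
          simpa only [run, if_pos (And.intro b1 b2)] using this
        · intro k hk
          exact (q4.trans q5 (by omega)).reg _ (by omega)
      · refine ⟨_, _, Exec.seq x0 <| Exec.seq x1 <| Exec.seq x2 <| Exec.seq x3 <| Exec.seq x4 <|
          Exec.ite_true (by omega) <| Exec.ite_false (by omega) (Exec.skip _), ?_, ?_, ?_⟩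
        · simp [cost]
          omega
        · simpa [run, b2] using h4
        · intro k hk
          exact q4.reg _ (by omega)
    · refine ⟨_, _, Exec.seq x0 <| Exec.seq x1 <| Exec.seq x2 <| Exec.seq x3 <| Exec.seq x4 <|
        Exec.ite_false (by omega) (Exec.skip _), ?_, ?_, ?_⟩
      · simp [cost]
        omega
      · simpa [run, b1] using h4
      · intro k hk
        exact q4.reg _ (by omega)
  | seq c₁ c₂ ih₁ ih₂ =>
    obtain ⟨t1, s1, x1, c1, r1, q1⟩ := ih₁ d S s h
    obtain ⟨t2, s2, x2, c2, r2, q2⟩ := ih₂ d _ s1 r1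
    refine ⟨_, _, Exec.seq x1 x2, ?_, r2, fun k hk => (q2 k hk).trans (q1 k hk)⟩
    simp [cost]
    omega
  | ite e c₁ c₂ ih₁ ih₂ =>
    obtain ⟨t0, s0, x0, c0, r0, q0⟩ := e.compile_exec d s h
    have h0 := h.of_tempEq q0
    by_cases he : e.eval n S = 0
    · obtain ⟨t1, s1, x1, c1, r1, q1⟩ := ih₂ d S s0 h0
      refine ⟨_, _, Exec.seq x0 (Exec.ite_false (by rw [r0, he]) x1), ?_, ?_, ?_⟩
      · simp [cost]
        omega
      · simpa [run, he] using r1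
      · exact fun k hk => (q1 k hk).trans (q0.reg _ (by omega))
    · obtain ⟨t1, s1, x1, c1, r1, q1⟩ := ih₁ d S s0 h0
      refine ⟨_, _, Exec.seq x0 (Exec.ite_true (by rwa [r0]) x1), ?_, ?_, ?_⟩
      · simp [cost]
        omega
      · simpa [run, he] using r1
      · exact fun k hk => (q1 k hk).trans (q0.reg _ (by omega))
  | each v c ih =>
    -- With `k` rounds left, the values still to be processed are `n - k, …, n - 1`, that is
    -- `List.range' (n - k) k`.
    have hloop : ∀ k ≤ n, ∀ (S : Store) (s : RamState), Represents n S s → s.reg (2 * d + 2) = k →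
        ∃ t s', Exec (.loop (2 * d + 2) <| .seq (.sub (2 * v + 1) 0 (2 * d + 2)) <|
          .seq (c.compile (d + 1)) <|
          .seq (.const (2 * d + 4) 1) (.sub (2 * d + 2) (2 * d + 2) (2 * d + 4))) s t s' ∧
          t ≤ k * (c.cost.eval n + 4) + 1 ∧
          Represents n ((List.range' (n - k) k).foldl (fun S i => c.run n (S.set v i)) S) s' ∧
          ∀ k < d, s'.reg (2 * k + 2) = s.reg (2 * k + 2) := by
      intro k
      induction k with
      | zero =>
        intro _ S s h hk
        exact ⟨_, _, Exec.loop_done hk, by omega, by simpa using h, fun _ _ => rfl⟩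
      | succ k ihk =>
        intro hkn S s h hk
        have h1 := h.set v (n - (k + 1))
        have x1 := Exec.sub (2 * v + 1) 0 (2 * d + 2) s
        rw [h.size, hk] at x1
        obtain ⟨t2, s2, x2, c2, r2, q2⟩ := ih (d + 1) _ _ h1
        have x3 := Exec.seq (Exec.const (2 * d + 4) 1 s2)
          (Exec.sub (2 * d + 2) (2 * d + 2) (2 * d + 4) _)
        have hk2 : s2.reg (2 * d + 2) = k + 1 := by
          rw [q2 d (by omega)]
          simp only
          rw [Function.update_of_ne (by omega), hk]
        have q3 : TempEq d s2 _ := (tempEq_update (k := 2 * d + 4) s2 1 (by omega) (by omega)).trans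
          (tempEq_update (k := 2 * d + 2) _
            (Function.update s2.reg (2 * d + 4) 1 (2 * d + 2) -
              Function.update s2.reg (2 * d + 4) 1 (2 * d + 4)) (by omega) le_rfl) le_rfl
        have h3 := r2.of_tempEq q3
        obtain ⟨t4, s4, x4, c4, r4, q4⟩ := ihk (by omega) _ _ h3 (by simp [hk2])
        refine ⟨_, _, Exec.loop_again (by omega) (Exec.seq x1 (Exec.seq x2 x3)) x4, ?_, ?_, ?_⟩
        · rw [Nat.succ_mul]
          omega
        · rw [List.range'_succ, List.foldl_cons, show n - (k + 1) + 1 = n - k by omega]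
          exact r4
        · intro j hj
          rw [q4 j hj, q3.reg _ (by omega), q2 j (by omega)]
          simp only
          rw [Function.update_of_ne (by omega)]
    have q1 : TempEq d s _ := (tempEq_update (k := 2 * d + 2) s 0 (by omega) le_rfl).trans
      (tempEq_update (k := 2 * d + 2) _ (Function.update s.reg (2 * d + 2) 0 (2 * d + 2) +
        Function.update s.reg (2 * d + 2) 0 0) (by omega) le_rfl) le_rfl
    obtain ⟨t2, s2, x2, c2, r2, q2⟩ := hloop n le_rfl S _ (h.of_tempEq q1) (by simp [h.size])
    refine ⟨_, _, Exec.seq (Exec.const _ _ _) (Exec.seq (Exec.add _ _ _ _) x2), ?_, ?_, ?_⟩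
    · simp [cost]
      omega
    · simpa [run, List.range_eq_range'] using r2
    · exact fun k hk => (q2 k hk).trans (q1.reg _ (by omega))

/-! ### Reasoning about structured commands -/

/-- The variables that a command sets. -/
def Cmd.vars : Cmd → List ℕ
  | skip => []
  | set v _ => [v]
  | write _ _ _ _ => []
  | seq c₁ c₂ => c₁.vars ++ c₂.vars
  | ite _ c₁ c₂ => c₁.vars ++ c₂.vars
  | each v c => v :: c.vars

/-- The arrays to which a command writes. -/
def Cmd.arrays : Cmd → List ℕ
  | skip => []
  | set _ _ => []
  | write a _ _ _ => [a]
  | seq c₁ c₂ => c₁.arrays ++ c₂.arrays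
  | ite _ c₁ c₂ => c₁.arrays ++ c₂.arrays
  | each _ c => c.arrays

theorem Cmd.run_var {n v : ℕ} {c : Cmd} (h : v ∉ c.vars) (S : Store) :
    (c.run n S).var v = S.var v := by
  induction c generalizing S with
  | skip => rfl
  | set u e =>
    have : v ≠ u := by simpa [vars] using h
    simp [run, Store.set, this]
  | write a i j e =>
    simp only [run]
    split_ifs <;> rfl
  | seq c₁ c₂ ih₁ ih₂ =>
    simp only [vars, List.mem_append, not_or] at h
    simp only [run]
    rw [ih₂ h.2, ih₁ h.1]
  | ite e c₁ c₂ ih₁ ih₂ =>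
    simp only [vars, List.mem_append, not_or] at h
    simp only [run]
    split_ifs
    · exact ih₁ h.1 S
    · exact ih₂ h.2 S
  | each u c ih =>
    simp only [vars, List.mem_cons, not_or] at h
    simp only [run]
    induction List.range n generalizing S with
    | nil => rfl
    | cons i L ihL =>
      rw [List.foldl_cons, ihL, ih h.2]
      simp [Store.set, h.1]

theorem Cmd.run_arr {n a : ℕ} {c : Cmd} (h : a ∉ c.arrays) (S : Store) :
    (c.run n S).arr a = S.arr a := by
  induction c generalizing S with
  | skip => rfl
  | set u e => rfl
  | write b i j e =>
    have : a ≠ b := by simpa [arrays] using h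
    simp only [run]
    split_ifs
    · simp [Store.write, this]
    · rfl
  | seq c₁ c₂ ih₁ ih₂ =>
    simp only [arrays, List.mem_append, not_or] at h
    simp only [run]
    rw [ih₂ h.2, ih₁ h.1]
  | ite e c₁ c₂ ih₁ ih₂ =>
    simp only [arrays, List.mem_append, not_or] at h
    simp only [run]
    split_ifs
    · exact ih₁ h.1 S
    · exact ih₂ h.2 S
  | each u c ih =>
    simp only [run]
    induction List.range n generalizing S with
    | nil => rfl
    | cons i L ihL =>
      rw [List.foldl_cons, ihL, ih h]
      rfl

theorem Cmd.run_each_inv {n v : ℕ} {c : Cmd} {S : Store} (I : ℕ → Store → Prop) (h₀ : I 0 S)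
    (hstep : ∀ i < n, ∀ S, I i S → I (i + 1) (c.run n (S.set v i))) :
    I n ((each v c).run n S) := by
  have : ∀ k ≤ n, I k ((List.range k).foldl (fun S i => c.run n (S.set v i)) S) := by
    intro k
    induction k with
    | zero => exact fun _ => h₀
    | succ k ih =>
      intro hk
      rw [List.range_succ, List.foldl_append]
      exact hstep k hk _ (ih (by omega))
  exact this n le_rfl

/-- Apply `f 0`, …, `f (n - 1)` in turn. -/
def sweep {n : ℕ} {α : Type*} (f : Fin n → α → α) (a : α) : α :=
  (List.finRange n).foldl (fun a i => f i a) a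

/-- A simulation rule: if the body carries out `f i` on the data that the store represents, the loop
carries out the sweep. Nested loops are thus verified one body at a time. -/
theorem Cmd.run_each_sweep {n v : ℕ} {c : Cmd} {α : Type*} {f : Fin n → α → α}
    (R : Store → α → Prop) (hstep : ∀ (i : Fin n) S a, R S a → R (c.run n (S.set v i)) (f i a))
    {S : Store} {a : α} (h : R S a) : R ((each v c).run n S) (sweep f a) := by
  have : ∀ (L : List (Fin n)) S a, R S a →
      R ((L.map Fin.val).foldl (fun S i => c.run n (S.set v i)) S)
        (L.foldl (fun a i => f i a) a) := by
    intro L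
    induction L with
    | nil => exact fun S a h => h
    | cons i L ih => exact fun S a h => ih _ _ (hstep i S a h)
  have := this (List.finRange n) S a h
  rwa [List.map_coe_finRange_eq_range] at this

/-! ### Sweeps that decrease a potential -/

/-- `f` preserves `Inv`, and it decreases the potential `Φ` whenever it changes its argument. -/
def Improves {α : Type*} (Inv : α → Prop) (Φ : α → ℕ) (f : α → α) : Prop :=
  ∀ a, Inv a → Inv (f a) ∧ (f a = a ∨ Φ (f a) < Φ a)

theorem Improves.sweep {n : ℕ} {α : Type*} {Inv : α → Prop} {Φ : α → ℕ} {f : Fin n → α → α}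
    (h : ∀ i, Improves Inv Φ (f i)) : Improves Inv Φ (sweep f) := by
  intro a ha
  unfold AccompliceGame.sweep
  induction List.finRange n generalizing a with
  | nil => exact ⟨ha, Or.inl rfl⟩
  | cons i L ih =>
    obtain ⟨h1, h2⟩ := h i a ha
    obtain ⟨h3, h4⟩ := ih _ h1
    refine ⟨h3, ?_⟩
    rw [List.foldl_cons]
    rcases h2 with h2 | h2
    · rwa [h2] at h4 ⊢
    · rcases h4 with h4 | h4
      · rw [h4]
        exact Or.inr h2
      · exact Or.inr (h4.trans h2)

/-- The potential never rises and drops at every real change, so a sweep that ends where it began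
cannot have changed anything on the way. -/
theorem Improves.fixed_of_sweep {n : ℕ} {α : Type*} {Inv : α → Prop} {Φ : α → ℕ}
    {f : Fin n → α → α} (h : ∀ i, Improves Inv Φ (f i)) {a : α} (ha : Inv a)
    (hfix : AccompliceGame.sweep f a = a) (i : Fin n) : f i a = a := by
  have key : ∀ L : List (Fin n), ∀ b, Inv b →
      Φ (L.foldl (fun a i => f i a) b) ≤ Φ b ∧
        (L.foldl (fun a i => f i a) b = b → ∀ i ∈ L, f i b = b) := by
    intro L
    induction L with
    | nil => exact fun b hb => ⟨le_rfl, by simp⟩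
    | cons i L ih =>
      intro b hb
      obtain ⟨h1, h2⟩ := h i b hb
      obtain ⟨h3, h4⟩ := ih _ h1
      rw [List.foldl_cons]
      rcases h2 with h2 | h2
      · rw [h2] at h3 h4 ⊢
        exact ⟨h3, fun e j hj => (List.mem_cons.1 hj).elim (fun e => e ▸ h2) (h4 e j)⟩
      · exact ⟨h3.trans h2.le, fun e => absurd (h3.trans_lt h2) (by rw [e]; exact lt_irrefl _)⟩
  exact (key _ a ha).2 hfix i (List.mem_finRange i)

theorem Improves.iterate {α : Type*} {Inv : α → Prop} {Φ : α → ℕ} {f : α → α}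
    (h : Improves Inv Φ f) {a : α} (ha : Inv a) (k : ℕ) :
    Inv (f^[k] a) ∧ (f (f^[k] a) = f^[k] a ∨ Φ (f^[k] a) + k ≤ Φ a) := by
  induction k with
  | zero => exact ⟨ha, Or.inr le_rfl⟩
  | succ k ih =>
    rw [Function.iterate_succ_apply']
    obtain ⟨h1, h2⟩ := h _ ih.1
    refine ⟨h1, ?_⟩
    rcases h2 with h2 | h2
    · left
      rw [h2, h2]
    · rcases ih.2 with h3 | h3
      · left
        rw [h3, h3]
      · right
        omega

theorem sweep_const {n : ℕ} {α : Type*} (f : α → α) : sweep (fun _ : Fin n => f) = f^[n] := by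
  funext a
  unfold sweep
  rw [List.foldl_const, List.length_finRange]

/-- Two nested loops whose counters the body ignores iterate it `n * n` times, which is how the
program gets its repetition counts. -/
theorem sweep_sweep_const {n : ℕ} {α : Type*} (f : α → α) :
    sweep (fun _ : Fin n => sweep fun _ : Fin n => f) = f^[n * n] := by
  rw [sweep_const, sweep_const, Function.iterate_mul]

/-- A potential of the form `∑ i, (n - 1 - x i)` drops within `n * n` steps to a fixed point. -/
theorem Improves.fixed_of_sum {n : ℕ} {α : Type*} {Inv : α → Prop} {x : α → Fin n → ℕ} {f : α → α}
    (h : Improves Inv (fun a => ∑ i, (n - 1 - x a i)) f) {a : α} (ha : Inv a) (hn : 0 < n) :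
    Inv (f^[n * n] a) ∧ f (f^[n * n] a) = f^[n * n] a := by
  obtain ⟨h1, h2⟩ := h.iterate ha (n * n)
  refine ⟨h1, h2.resolve_right fun h3 => ?_⟩
  have h4 : ∑ i, (n - 1 - x a i) ≤ ∑ _i : Fin n, (n - 1) :=
    Finset.sum_le_sum fun i _ => Nat.sub_le _ _
  simp only [Finset.sum_const, Finset.card_univ, Fintype.card_fin, smul_eq_mul] at h4
  have h5 : n * (n - 1) < n * n := Nat.mul_lt_mul_of_pos_left (by omega) hn
  omega

/-! ### Deferred acceptance by single rejections -/

/-- Reject `m` if he addresses the same woman as `m'`, and she prefers `m'`. -/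
def rejectStep {n : ℕ} (q p : Profile n) (m m' : Fin n) (r : Fin n → ℕ) : Fin n → ℕ :=
  if ∃ w, ProposesTo p r m w ∧ ProposesTo p r m' w ∧ Prefers (q w) m' m then
    Function.update r m (r m + 1)
  else r

def rejectPass {n : ℕ} (q p : Profile n) : (Fin n → ℕ) → Fin n → ℕ :=
  sweep fun m => sweep fun m' => rejectStep q p m m'

/-- The numbers `r` of rejections can occur when the rejections take place in some order. -/
structure IsReachable {n : ℕ} (q p : Profile n) (r : Fin n → ℕ) : Prop where
  held : ∀ m w, ((p m).symm w : ℕ) < r m → ∃ m', ProposesTo p r m' w ∧ Prefers (q w) m' m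
  le : ∀ m, r m ≤ daState q p (n * n) m

theorem isReachable_zero {n : ℕ} (q p : Profile n) : IsReachable q p fun _ => 0 :=
  ⟨fun _ _ h => absurd h (Nat.not_lt_zero _), fun _ => Nat.zero_le _⟩

theorem IsReachable.lt {n : ℕ} {q p : Profile n} {r : Fin n → ℕ} (h : IsReachable q p r)
    (m : Fin n) : r m < n :=
  (h.le m).trans_lt (daState_lt q p _ m)

/-- The bound `le` survives because a man at his final position is never rejected: the rejecting
woman would be his final partner, and her better suitor `m'`, who ends up further down his list,
would block the deferred acceptance matching with her. -/
theorem IsReachable.step {n : ℕ} {q p : Profile n} {r : Fin n → ℕ} (h : IsReachable q p r)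
    {m m' w : Fin n} (h1 : ProposesTo p r m w) (h2 : ProposesTo p r m' w)
    (h3 : Prefers (q w) m' m) : IsReachable q p (Function.update r m (r m + 1)) := by
  have hne : m' ≠ m := h3.ne
  have h2' : ProposesTo p (Function.update r m (r m + 1)) m' w := by
    rw [ProposesTo, Function.update_of_ne hne]
    exact h2
  have hheld : ∀ x v, ((p x).symm v : ℕ) < r x ∨ (x = m ∧ v = w) →
      ∃ y, ProposesTo p (Function.update r m (r m + 1)) y v ∧ Prefers (q v) y x := by
    rintro x v (hx | ⟨rfl, rfl⟩)
    · obtain ⟨y, hy, hyx⟩ := h.held x v hx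
      by_cases hym : y = m
      · subst hym
        obtain rfl := hy.unique h1
        exact ⟨m', h2', h3.trans hyx⟩
      · refine ⟨y, ?_, hyx⟩
        rw [ProposesTo, Function.update_of_ne hym]
        exact hy
    · exact ⟨m', h2', h3⟩
  refine ⟨fun x v hx => hheld x v ?_, fun x => ?_⟩
  · by_cases hxm : x = m
    · subst hxm
      rw [Function.update_self] at hx
      rcases Nat.lt_succ_iff_lt_or_eq.1 hx with hx | hx
      · exact Or.inl hx
      · exact Or.inr ⟨rfl, ProposesTo.unique (show ProposesTo p r x v from hx) h1⟩
    · rw [Function.update_of_ne hxm] at hx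
      exact Or.inl hx
  · by_cases hxm : x = m
    · subst hxm
      rw [Function.update_self]
      refine lt_of_le_of_ne (h.le x) fun e => ?_
      have hw : DA q p x = w := by
        refine (proposesTo_DA q p x).unique ?_
        rw [ProposesTo, ← e]
        exact h1
      have hw' : (DA q p).symm w = x := by rw [← hw, Equiv.symm_apply_apply]
      refine DA_mem_stableSet q p m' w ⟨?_, by rwa [hw']⟩
      refine Prefers.of_not (fun hlt => ?_) fun e => hne ((DA q p).injective (e.trans hw.symm))
      have h4 : ((p m').symm (DA q p m') : ℕ) < (p m').symm w := hlt
      rw [position_DA, h2] at h4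
      exact absurd (h.le m') (not_le.2 h4)
    · rw [Function.update_of_ne hxm]
      exact h.le x

/-- The parallel rounds cannot overtake a state `r` without pending rejections. If `m` were the
first to do so, his competitor either still addresses the woman in `r`, or has been rejected by her
there, and then `held` provides an even better suitor; in both cases `m` would be rejected in `r`.
-/
theorem IsReachable.eq_daState {n : ℕ} {q p : Profile n} {r : Fin n → ℕ} (h : IsReachable q p r)
    (hr : ∀ m, ¬ IsRejected q p r m) : r = daState q p (n * n) := by
  have hle : ∀ t m, daState q p t m ≤ r m := by
    intro t
    induction t with
    | zero => exact fun m => Nat.zero_le _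
    | succ t ih =>
      intro m
      rw [daState_succ, daRound]
      split_ifs with hm
      · refine lt_of_le_of_ne (ih m) fun e => ?_
        obtain ⟨w, m', h1, h2, h3⟩ := hm
        have h1' : ProposesTo p r m w := by rw [ProposesTo, ← e]; exact h1
        rcases (ih m').eq_or_lt with e' | hlt
        · exact hr m ⟨w, m', h1', by rw [ProposesTo, ← e']; exact h2, h3⟩
        · obtain ⟨y, hy, hym⟩ := h.held m' w (by rw [h2]; exact hlt)
          exact hr m ⟨w, y, h1', hy, hym.trans h3⟩
      · exact ih m
  exact funext fun m => le_antisymm (h.le m) (hle _ m)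

theorem sum_sub_lt_sum_sub {n : ℕ} {x y : Fin n → ℕ} (hle : ∀ i, x i ≤ y i) (m : Fin n)
    (hm : x m < y m) (hy : y m < n) : ∑ i, (n - 1 - y i) < ∑ i, (n - 1 - x i) :=
  Finset.sum_lt_sum (fun i _ => Nat.sub_le_sub_left (hle i) _) ⟨m, Finset.mem_univ _, by omega⟩

theorem improves_rejectStep {n : ℕ} (q p : Profile n) (m m' : Fin n) :
    Improves (IsReachable q p) (fun r => ∑ i, (n - 1 - r i)) (rejectStep q p m m') := by
  intro r hr
  unfold rejectStep
  split_ifs with h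
  · obtain ⟨w, h1, h2, h3⟩ := h
    have hr' := hr.step h1 h2 h3
    refine ⟨hr', Or.inr (sum_sub_lt_sum_sub (fun i => ?_) m ?_ (hr'.lt m))⟩
    · by_cases hi : i = m
      · subst hi; simp
      · rw [Function.update_of_ne hi]
    · simp
  · exact ⟨hr, Or.inl rfl⟩

/-- Every pass that is not idle uses up part of a potential of at most `n * (n - 1)`. After `n * n`
passes no pair triggers a rejection, and the order of rejections is immaterial by
`IsReachable.eq_daState`. -/
theorem rejectPass_iterate {n : ℕ} (q p : Profile n) :
    (rejectPass q p)^[n * n] (fun _ => 0) = daState q p (n * n) := by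
  rcases Nat.eq_zero_or_pos n with rfl | hn
  · exact funext fun m => m.elim0
  have himp := improves_rejectStep q p
  obtain ⟨h1, h2⟩ := Improves.fixed_of_sum (x := fun r => r)
    (Improves.sweep fun m => Improves.sweep (himp m)) (isReachable_zero q p) hn
  change IsReachable q p ((rejectPass q p)^[n * n] fun _ => 0) at h1
  refine h1.eq_daState ?_
  rintro m ⟨w, m', h3, h4, h5⟩
  have h6 := Improves.fixed_of_sweep (himp m) h1
    (Improves.fixed_of_sweep (fun m => Improves.sweep (himp m)) h1 h2 m) m'
  rw [rejectStep, if_pos ⟨w, h3, h4, h5⟩] at h6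
  have := congrFun h6 m
  simp at this

/-! ### Pushing up a single woman -/

/-- Move the agent in position `k` up to the position `b`. -/
def moveUp {n : ℕ} (l : PrefList n) (b k : Fin n) : PrefList n := l * (Fin.cycleIcc b k)⁻¹

theorem cycleIcc_val {n : ℕ} {b k : Fin n} (h : b < k) (i : Fin n) :
    (Fin.cycleIcc b k i : ℕ) =
      if i < b then (i : ℕ) else if i < k then i + 1 else if i = k then (b : ℕ) else i := by
  have : NeZero n := ⟨by have := i.2; omega⟩
  split_ifs with h1 h2 h3
  · rw [Fin.cycleIcc_of_lt h1]
  · rw [Fin.cycleIcc_of_ge_of_lt (not_lt.1 h1) h2]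
    exact Fin.val_add_one_of_lt' (by have := k.2; have := Fin.lt_def.1 h2; omega)
  · rw [h3, Fin.cycleIcc_of_last h.le]
  · rw [Fin.cycleIcc_of_gt (lt_of_le_of_ne (not_lt.1 h2) (Ne.symm h3))]

theorem moveUp_position {n : ℕ} (l : PrefList n) (b k w : Fin n) :
    (moveUp l b k).symm w = Fin.cycleIcc b k (l.symm w) := by
  rw [Equiv.symm_apply_eq]
  simp [moveUp]

theorem prefers_moveUp {n : ℕ} {l : PrefList n} {b k : Fin n} (h : b < k) (w : Fin n) :
    Prefers (moveUp l b k) w (l b) ↔ Prefers l w (l b) ∨ w = l k := by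
  have hw : w = l k ↔ (l.symm w : ℕ) = k := by
    rw [← Equiv.symm_apply_eq, Fin.ext_iff]
  simp only [Prefers, moveUp_position, Fin.lt_def, cycleIcc_val h, Equiv.symm_apply_apply,
    Fin.ext_iff, hw]
  have := Fin.lt_def.1 h
  split_ifs <;> omega

theorem isPushUp_moveUp {n : ℕ} {l : PrefList n} {b k : Fin n} (h : b < k) :
    IsPushUp l (moveUp l b k) (l b) := by
  refine ⟨{l k}, ?_, fun w => ?_, fun w₁ w₂ => ?_⟩
  · simp [h.ne]
  · rw [prefers_moveUp h, Finset.mem_singleton]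
  · simp only [Prefers, moveUp_position, Fin.lt_def, cycleIcc_val h, Equiv.symm_apply_apply,
      Fin.ext_iff]
    have := Fin.lt_def.1 h
    split_ifs <;> omega

open Classical in
/-- Let `m` push up the woman in position `k` of his list just above his partner, if she is below him
and this does not change his partner. -/
noncomputable def pushStep {n : ℕ} (q : Profile n) (m k : Fin n) (p : Profile n) : Profile n :=
  if (p m).symm (DA q p m) < k ∧
      DA q (Function.update p m (moveUp (p m) ((p m).symm (DA q p m)) k)) m = DA q p m then
    Function.update p m (moveUp (p m) ((p m).symm (DA q p m)) k)
  else p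

/-- The man `m` keeps his partner, who slips by exactly one position in his list. The new outcome is
stable for the old lists, so the unchanged list of every other man ranks his new partner no higher
than his old, optimal one. -/
theorem improves_pushStep {n : ℕ} (I : Market n) (P : Finset (Fin n × Fin n)) {m w : Fin n}
    (hmw : (m, w) ∈ P) (k : Fin n) :
    Improves (IsTame I P) (fun p => ∑ i, (n - 1 - ((p i).symm (DA I.women p i) : ℕ)))
      (pushStep I.women m k) := by
  intro p hp
  unfold pushStep
  split_ifs with h
  · obtain ⟨h1, h2⟩ := h
    have hpu := isPushUp_moveUp (l := p m) h1
    rw [Equiv.apply_symm_apply] at hpu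
    have hs := stableSet_subset_of_pushUp hpu h2 (DA_mem_stableSet I.women _)
    have hpos : ((moveUp (p m) ((p m).symm (DA I.women p m)) k).symm (DA I.women p m) : ℕ) =
        (p m).symm (DA I.women p m) + 1 := by
      rw [moveUp_position, cycleIcc_val h1, if_neg (lt_irrefl _), if_pos h1]
    have hlt : ((Function.update p m (moveUp (p m) ((p m).symm (DA I.women p m)) k) m).symm
        (DA I.women (Function.update p m (moveUp (p m) ((p m).symm (DA I.women p m)) k)) m) : ℕ) =
        (p m).symm (DA I.women p m) + 1 := by
      rw [h2, Function.update_self, hpos]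
    refine ⟨hp.pushUp hmw hpu h2, Or.inr (sum_sub_lt_sum_sub (fun i => ?_) m ?_ (Fin.is_lt _))⟩
    · by_cases hi : i = m
      · subst hi
        rw [hlt]
        exact Nat.le_succ _
      · rw [Function.update_of_ne hi]
        exact not_lt.1 (DA_man_optimal hs i)
    · rw [hlt]
      exact Nat.lt_succ_self _
  · exact ⟨hp, Or.inl rfl⟩

/-- A manipulation would yield a woman `x` below the partner of `m` who can be pushed up harmlessly.
As `pushStep` changes nothing, `x` would already be above the partner. -/
theorem IsTame.isNashEquilibrium {n : ℕ} {I : Market n} {P : Finset (Fin n × Fin n)}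
    {p : Profile n} (hp : IsTame I P p)
    (hfix : ∀ m w, (m, w) ∈ P → ∀ k, pushStep I.women m k p = p) : IsNashEquilibrium I P p := by
  refine ⟨hp.strategic, fun m w hmw l hl => ?_⟩
  obtain ⟨x, hx, hx'⟩ := hp.exists_single_pushUp hl
  have habove : ∀ y, Prefers (moveUp (p m) ((p m).symm (DA I.women p m)) ((p m).symm x)) y
      (DA I.women p m) ↔ Prefers (p m) y (DA I.women p m) ∨ y = x := by
    intro y
    have := prefers_moveUp (l := p m) hx y
    rwa [Equiv.apply_symm_apply, Equiv.apply_symm_apply] at this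
  have h := hfix m w hmw ((p m).symm x)
  rw [pushStep, if_pos ⟨hx, hx' _ fun y hy => (habove y).1 hy⟩] at h
  have h2 := congrFun h m
  rw [Function.update_self] at h2
  rw [h2] at habove
  exact hx.asymm ((habove x).2 (Or.inr rfl))

-- The woman `w` matters only for deciding whether `m` is strategic; a man in several pairs is
-- simply swept several times. This form matches the loops of `Cmd.equilibrium`.
open Classical in
noncomputable def pushPass {n : ℕ} (I : Market n) (P : Finset (Fin n × Fin n)) :
    Profile n → Profile n :=
  sweep fun m => sweep fun w => if (m, w) ∈ P then sweep (pushStep I.women m) else id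

theorem isNashEquilibrium_pushPass {n : ℕ} (I : Market n) (P : Finset (Fin n × Fin n)) :
    IsNashEquilibrium I P ((pushPass I P)^[n * n] I.men) := by
  classical
  rcases Nat.eq_zero_or_pos n with rfl | hn
  · exact ⟨fun m => m.elim0, fun m => m.elim0⟩
  have h1 : ∀ m w, Improves (IsTame I P)
      (fun p => ∑ i, (n - 1 - ((p i).symm (DA I.women p i) : ℕ)))
      (if (m, w) ∈ P then sweep (pushStep I.women m) else id) := by
    intro m w
    split_ifs with h
    · exact Improves.sweep fun k => improves_pushStep I P h k
    · exact fun p hp => ⟨hp, Or.inl rfl⟩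
  have h2 := fun m => Improves.sweep (h1 m)
  obtain ⟨h3, h4⟩ := Improves.fixed_of_sum
    (x := fun p i => ((p i).symm (DA I.women p i) : ℕ)) (Improves.sweep h2) (isTame_men I P) hn
  refine IsTame.isNashEquilibrium (p := (pushPass I P)^[n * n] I.men) ?_ fun m w hmw k => ?_
  · unfold pushPass
    convert h3
  · have h5 := Improves.fixed_of_sweep (h1 m) h3 (Improves.fixed_of_sweep h2 h3 h4 m) w
    rw [if_pos hmw] at h5
    have h6 := Improves.fixed_of_sweep (fun k => improves_pushStep I P hmw k) h3 h5 k
    unfold pushPass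
    convert h6

/-! ### The program

The array `0` holds the reported lists, `1` the lists of the women, `2` the table of the strategic
pairs, `3` the positions of the men in the lists of the women, `4` a copy of the reported lists on
which deferred acceptance runs, and the diagonal of `5` the numbers of rejections. -/

def Holds {n : ℕ} (S : Store) (a : ℕ) (f : Fin n → Fin n → ℕ) : Prop :=
  ∀ i j : Fin n, S.arr a i j = f i j

namespace Cmd

/-- Compute the array `3` from the array `1`. -/
def rank : Cmd :=
  each 0 (each 1 (write 3 (.var 0) (.read 1 (.var 0) (.var 1)) (.var 1)))

/-- Copy the array `b` to the array `a`. -/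
def copy (a b : ℕ) : Cmd :=
  each 3 (each 4 (write a (.var 3) (.var 4) (.read b (.var 3) (.var 4))))

/-- The woman whom the man addresses. -/
def addressee (m : ℕ) : Expr := .read 4 (.var m) (.read 5 (.var m) (.var m))

/-- `rejectStep` for the men in the variables `5` and `6`. -/
def reject : Cmd :=
  ite (.add (.sub (addressee 5) (addressee 6)) (.sub (addressee 6) (addressee 5))) skip <|
    ite (.sub (.read 3 (addressee 5) (.var 5)) (.read 3 (addressee 5) (.var 6)))
      (write 5 (.var 5) (.var 5) (.add (.read 5 (.var 5) (.var 5)) (.const 1))) skip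

/-- Deferred acceptance. -/
def deferredAcceptance : Cmd :=
  seq (each 5 (write 5 (.var 5) (.var 5) (.const 0)))
    (each 3 (each 4 (each 5 (each 6 reject))))

/-- Set the entry of the array `4` for the man in the variable `0` and the position in the variable
`3` to its value after the woman in the position given by the variable `2` has moved up to the
position given by the variable `9`. -/
def moveUpAt : Cmd :=
  ite (.sub (.var 9) (.var 3)) skip <| ite (.sub (.var 3) (.var 2)) skip <|
    ite (.sub (.var 3) (.var 9))
      (write 4 (.var 0) (.var 3) (.read 0 (.var 0) (.sub (.var 3) (.const 1))))
      (write 4 (.var 0) (.var 3) (.read 0 (.var 0) (.var 2)))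

def moveUp : Cmd := each 3 moveUpAt

/-- Copy the array `4` to the array `0` if the man in the variable `0` addresses the woman in the
position given by the variable `9` of his list. -/
def commit : Cmd :=
  ite (.add (.sub (addressee 0) (.read 0 (.var 0) (.var 9)))
    (.sub (.read 0 (.var 0) (.var 9)) (addressee 0))) skip (copy 0 4)

/-- `pushStep` for the man in the variable `0` and the position in the variable `2`. -/
def push : Cmd :=
  seq (copy 4 0) <| seq deferredAcceptance <| seq (set 9 (.read 5 (.var 0) (.var 0))) <|
    ite (.sub (.var 2) (.var 9)) (seq moveUp (seq deferredAcceptance commit)) skip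

/-- Compute a Nash equilibrium. -/
def equilibrium : Cmd :=
  seq rank <| each 7 <| each 8 <| each 0 <| each 1 <|
    ite (.read 2 (.var 0) (.var 1)) (each 2 push) skip

end Cmd

/-! ### Correctness of the program -/

variable {n : ℕ}

@[simp] theorem Store.set_arr (S : Store) (v x : ℕ) : (S.set v x).arr = S.arr := rfl

@[simp] theorem Store.set_var_self (S : Store) (v x : ℕ) : (S.set v x).var v = x := by
  simp [Store.set]

theorem Store.set_var_of_ne (S : Store) {v u : ℕ} (x : ℕ) (h : u ≠ v) :
    (S.set v x).var u = S.var u := by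
  simp [Store.set, h]

theorem Cmd.copy_holds {a b : ℕ} (hab : b ≠ a) {S : Store} {f : Fin n → Fin n → ℕ}
    (h : Holds S b f) : Holds ((copy a b).run n S) a f := by
  have key := run_each_inv (n := n) (v := 3)
    (c := each 4 (write a (.var 3) (.var 4) (.read b (.var 3) (.var 4)))) (S := S)
    (fun i S => Holds S b f ∧ ∀ i' j' : Fin n, (i' : ℕ) < i → S.arr a i' j' = f i' j')
    ⟨h, fun _ _ h => absurd h (Nat.not_lt_zero _)⟩ (by
      rintro i hi S ⟨h1, h2⟩
      have key := run_each_inv (n := n) (v := 4)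
        (c := write a (.var 3) (.var 4) (.read b (.var 3) (.var 4))) (S := S.set 3 i)
        (fun j S => S.var 3 = i ∧ Holds S b f ∧
          ∀ i' j' : Fin n, (i' : ℕ) < i ∨ ((i' : ℕ) = i ∧ (j' : ℕ) < j) → S.arr a i' j' = f i' j')
        ⟨by simp, h1, fun i' j' h => h2 i' j' (by omega)⟩ (by
          rintro j hj S ⟨h0, h1, h2⟩
          have e3 : (S.set 4 j).var 3 = i := by rw [Store.set_var_of_ne _ _ (by omega), h0]
          have e4 := S.set_var_self 4 j
          have hb := h1 ⟨i, hi⟩ ⟨j, hj⟩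
          simp only at hb
          refine ⟨?_, fun i' j' => ?_, fun i' j' h' => ?_⟩
          · rw [run_var (by simp [vars]), e3]
          · rw [run_arr (by simp [arrays, hab])]
            exact h1 i' j'
          · simp only [run, Expr.eval, e3, e4, hi, hj, and_self, if_true, Store.write,
              Store.set_arr, true_and]
            by_cases he : (i' : ℕ) = i ∧ (j' : ℕ) = j
            · rw [if_pos he, hb]
              congr 1 <;> exact Fin.ext (by simp [he])
            · rw [if_neg he]
              exact h2 i' j' (by omega))
      exact ⟨key.2.1, fun i' j' hlt => key.2.2 i' j' (by omega)⟩)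
  exact fun i j => key.2 i j i.2

/-- The array of the positions in the lists of `q`. -/
def positions (q : Profile n) : Fin n → Fin n → ℕ := fun w m => (q w).symm m

/-- The array of the entries of the lists of `p`. -/
def entries (p : Profile n) : Fin n → Fin n → ℕ := fun m k => p m k

theorem Cmd.rank_holds {q : Profile n} {S : Store} (h : Holds S 1 (entries q)) :
    Holds (rank.run n S) 3 (positions q) := by
  have key := run_each_inv (n := n) (v := 0)
    (c := each 1 (write 3 (.var 0) (.read 1 (.var 0) (.var 1)) (.var 1))) (S := S)
    (fun i S => Holds S 1 (entries q) ∧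
      ∀ i' j' : Fin n, (i' : ℕ) < i → S.arr 3 i' j' = positions q i' j')
    ⟨h, fun _ _ h => absurd h (Nat.not_lt_zero _)⟩ (by
      rintro i hi S ⟨h1, h2⟩
      have key := run_each_inv (n := n) (v := 1)
        (c := write 3 (.var 0) (.read 1 (.var 0) (.var 1)) (.var 1)) (S := S.set 0 i)
        (fun j S => S.var 0 = i ∧ Holds S 1 (entries q) ∧
          -- The inner loop runs over positions rather than men, so the part of the current row
          -- already filled consists of the men whose position is less than `j`.
          ∀ i' j' : Fin n, (i' : ℕ) < i ∨ ((i' : ℕ) = i ∧ positions q i' j' < j) →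
            S.arr 3 i' j' = positions q i' j')
        ⟨by simp, h1, fun i' j' h => h2 i' j' (by omega)⟩ (by
          rintro j hj S ⟨h0, h1, h2⟩
          have e3 : (S.set 1 j).var 0 = i := by rw [Store.set_var_of_ne _ _ (by omega), h0]
          have e4 := S.set_var_self 1 j
          have hb : S.arr 1 i j = (q ⟨i, hi⟩ ⟨j, hj⟩ : ℕ) := h1 ⟨i, hi⟩ ⟨j, hj⟩
          refine ⟨?_, fun i' j' => ?_, fun i' j' h' => ?_⟩
          · rw [run_var (by simp [vars]), e3]
          · rw [run_arr (by simp [arrays])]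
            exact h1 i' j'
          · simp only [run, Expr.eval, e3, e4, hi, hj, and_self, if_true, Store.write,
              Store.set_arr, true_and, hb, Fin.is_lt]
            by_cases he : (i' : ℕ) = i ∧ (j' : ℕ) = (q ⟨i, hi⟩ ⟨j, hj⟩ : ℕ)
            · rw [if_pos he]
              obtain rfl : i' = ⟨i, hi⟩ := Fin.ext he.1
              obtain rfl : j' = _ := Fin.ext he.2
              simp [positions]
            · rw [if_neg he]
              refine h2 i' j' ?_
              rcases h' with h' | ⟨rfl, h'⟩
              · exact Or.inl h'
              · refine Or.inr ⟨rfl, lt_of_le_of_ne (Nat.lt_succ_iff.1 h') fun e => he ⟨rfl, ?_⟩⟩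
                have e' : (q i').symm j' = ⟨j, hj⟩ := Fin.ext e
                rw [Equiv.symm_apply_eq] at e'
                rw [e'])
      refine ⟨key.2.1, fun i' j' hlt => key.2.2 i' j' ?_⟩
      have : positions q i' j' < n := Fin.is_lt _
      omega)
  exact fun i j => key.2 i j i.2

/-- The store holds the data of deferred acceptance for `q` and `p`, after the rejections `r`. -/
structure HoldsRejections (q p : Profile n) (S : Store) (r : Fin n → ℕ) : Prop where
  ranks : Holds S 3 (positions q)
  lists : Holds S 4 (entries p)
  reachable : IsReachable q p r
  counts : ∀ m : Fin n, S.arr 5 m m = r m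

theorem addressee_eval {p : Profile n} {S : Store} {r : Fin n → ℕ} (hl : Holds S 4 (entries p))
    (hr : ∀ m : Fin n, S.arr 5 m m = r m) {v : ℕ} {m : Fin n} (hv : S.var v = m) (hm : r m < n) :
    (Cmd.addressee v).eval n S = p m ⟨r m, hm⟩ := by
  have := hl m ⟨r m, hm⟩
  simp only at this
  simp [Cmd.addressee, Expr.eval, hv, hr, hm, this, entries]

/-- The test for inequality that truncated subtraction permits. -/
theorem sub_add_sub_ne_zero {a b : ℕ} : (a - b) + (b - a) ≠ 0 ↔ a ≠ b := by omega

theorem HoldsRejections.reject {q p : Profile n} {S : Store} {r : Fin n → ℕ}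
    (h : HoldsRejections q p S r) {m m' : Fin n} (hm : S.var 5 = m) (hm' : S.var 6 = m') :
    HoldsRejections q p (Cmd.reject.run n S) (rejectStep q p m m' r) := by
  have hlt := h.reachable.lt m
  have hlt' := h.reachable.lt m'
  have hw : ProposesTo p r m (p m ⟨r m, hlt⟩) := by simp [ProposesTo]
  have hw' : ProposesTo p r m' (p m' ⟨r m', hlt'⟩) := by simp [ProposesTo]
  have e1 := addressee_eval h.lists h.counts hm hlt
  have e2 := addressee_eval h.lists h.counts hm' hlt'
  have reach := ((improves_rejectStep q p m m') r h.reachable).1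
  have hr1 := h.ranks (p m ⟨r m, hlt⟩) m
  have hr2 := h.ranks (p m ⟨r m, hlt⟩) m'
  have run_eq : Cmd.reject.run n S =
      if (p m ⟨r m, hlt⟩ : ℕ) = p m' ⟨r m', hlt'⟩ ∧
        Prefers (q (p m ⟨r m, hlt⟩)) m' m then S.write 5 m m (r m + 1) else S := by
    simp only [Cmd.reject, Cmd.run, Expr.eval, e1, e2, hm, hm', Fin.is_lt, and_self, if_true, hr1,
      hr2, h.counts, sub_add_sub_ne_zero, positions, Prefers, Fin.lt_def]
    split_ifs
    all_goals first | rfl | omega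
  have step_eq : rejectStep q p m m' r =
      if (p m ⟨r m, hlt⟩ : ℕ) = p m' ⟨r m', hlt'⟩ ∧
        Prefers (q (p m ⟨r m, hlt⟩)) m' m then Function.update r m (r m + 1) else r := by
    unfold rejectStep
    congr 1
    refine propext ⟨?_, ?_⟩
    · rintro ⟨w, h1, h2, h3⟩
      rw [hw.unique h1, hw'.unique h2]
      exact ⟨rfl, h3⟩
    · rintro ⟨h1, h2⟩
      exact ⟨_, hw, by rw [Fin.ext h1]; exact hw', h2⟩
  rw [step_eq] at reach ⊢
  rw [run_eq]
  split_ifs at reach ⊢ with hc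
  · refine ⟨fun i j => ?_, fun i j => ?_, reach, fun i => ?_⟩
    · simpa [Store.write] using h.ranks i j
    · simpa [Store.write] using h.lists i j
    · by_cases hi : i = m
      · subst hi; simp [Store.write]
      · have : (i : ℕ) ≠ m := fun e => hi (Fin.ext e)
        simp [Store.write, hi, this, h.counts]
  · exact h

theorem HoldsRejections.of_arr {q p : Profile n} {S S' : Store} {r : Fin n → ℕ}
    (h : HoldsRejections q p S r) (hS : S'.arr = S.arr) : HoldsRejections q p S' r :=
  ⟨fun i j => by rw [hS]; exact h.ranks i j, fun i j => by rw [hS]; exact h.lists i j,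
    h.reachable, fun i => by rw [hS]; exact h.counts i⟩

theorem Cmd.deferredAcceptance_run {q p : Profile n} {S : Store} (hr : Holds S 3 (positions q))
    (hl : Holds S 4 (entries p)) :
    ∀ m : Fin n, (deferredAcceptance.run n S).arr 5 m m = daState q p (n * n) m := by
  have h0 : HoldsRejections q p
      ((each 5 (write 5 (.var 5) (.var 5) (.const 0))).run n S) fun _ => 0 := by
    have key := run_each_inv (n := n) (v := 5) (c := write 5 (.var 5) (.var 5) (.const 0))
      (S := S) (fun i S => ∀ m : Fin n, (m : ℕ) < i → S.arr 5 m m = 0)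
      (fun _ h => absurd h (Nat.not_lt_zero _)) (by
        intro i hi S h m hm
        simp only [run, Expr.eval, Store.set_var_self, hi, and_self, if_true, Store.write, true_and,
          Store.set_arr]
        split_ifs with hmi
        · rfl
        · exact h m (by omega))
    refine ⟨fun i j => ?_, fun i j => ?_, isReachable_zero q p, fun m => key m m.2⟩
    · rw [run_arr (by simp [arrays])]
      exact hr i j
    · rw [run_arr (by simp [arrays])]
      exact hl i j
  have hpass : ∀ (S : Store) (r : Fin n → ℕ), HoldsRejections q p S r →
      HoldsRejections q p ((each 5 (each 6 reject)).run n S) (rejectPass q p r) := by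
    intro S r h
    refine run_each_sweep (HoldsRejections q p) (fun m S r h => ?_) h
    refine (run_each_sweep (fun S r => HoldsRejections q p S r ∧ S.var 5 = m)
      (fun m' S r h => ?_) ⟨h.of_arr (S.set_arr 5 m), S.set_var_self 5 m⟩).1
    have h5 : (S.set 6 m').var 5 = m := by rw [Store.set_var_of_ne _ _ (by omega), h.2]
    refine ⟨(h.1.of_arr (S.set_arr 6 m')).reject h5 (S.set_var_self 6 m'), ?_⟩
    rw [run_var (by simp [reject, vars]), h5]
  have h1 := run_each_sweep (n := n) (v := 3) (c := each 4 (each 5 (each 6 reject)))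
    (f := fun _ => sweep fun _ => rejectPass q p) (HoldsRejections q p) (fun i S r h =>
      run_each_sweep (HoldsRejections q p) (fun j S r h => hpass _ _ (h.of_arr (S.set_arr 4 j)))
        (h.of_arr (S.set_arr 3 i))) h0
  rw [sweep_sweep_const, rejectPass_iterate] at h1
  exact h1.counts

/-- The tests separate `j < b` and `k < j`, where the list is unchanged, from `b < j ≤ k`, where the
entry comes from position `j - 1`, and `j = b`, where it comes from `k`. -/
theorem Cmd.moveUpAt_run {p : Profile n} {m b k j : Fin n} {S : Store} (hbk : b < k)
    (h0 : Holds S 0 (entries p)) (hm : S.var 0 = m) (hk : S.var 2 = k) (hb : S.var 9 = b)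
    (hj : S.var 3 = j) :
    (moveUpAt.run n S = S ∧ AccompliceGame.moveUp (p m) b k j = p m j) ∨
      moveUpAt.run n S = S.write 4 m j (AccompliceGame.moveUp (p m) b k j : ℕ) := by
  have hlist : ∀ i : Fin n, Fin.cycleIcc b k i = j →
      AccompliceGame.moveUp (p m) b k j = p m i := by
    rintro i rfl
    simp [AccompliceGame.moveUp]
  have hlt := Fin.lt_def.1 hbk
  simp only [moveUpAt, run, Expr.eval, hm, hk, hb, hj, Fin.is_lt, and_self, true_and,
    if_true]
  split_ifs with c1 c2 c3 c4
  · exact Or.inl ⟨rfl, hlist j (Fin.cycleIcc_of_lt (Fin.lt_def.2 (by omega)))⟩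
  · exact Or.inl ⟨rfl, hlist j (Fin.cycleIcc_of_gt (Fin.lt_def.2 (by omega)))⟩
  · have hj' : (j : ℕ) - 1 < n := c4
    have h1 := h0 m ⟨(j : ℕ) - 1, hj'⟩
    simp only [entries] at h1
    rw [h1, hlist ⟨(j : ℕ) - 1, hj'⟩]
    · exact Or.inr rfl
    · apply Fin.ext
      rw [cycleIcc_val hbk, if_neg, if_pos]
      · simp only
        omega
      · rw [Fin.lt_def]
        simp only
        omega
      · rw [Fin.lt_def]
        simp only
        omega
  · have := j.2
    omega
  · have hjb : j = b := Fin.ext (by omega)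
    rw [h0 m k, hlist k]
    · exact Or.inr rfl
    · rw [hjb]
      apply Fin.ext
      rw [cycleIcc_val hbk, if_neg (not_lt.2 hbk.le), if_neg (lt_irrefl _), if_pos rfl]

theorem Cmd.moveUp_holds {p : Profile n} {m b k : Fin n} {S : Store} (hbk : b < k)
    (h0 : Holds S 0 (entries p)) (h4 : Holds S 4 (entries p)) (hm : S.var 0 = m)
    (hk : S.var 2 = k) (hb : S.var 9 = b) :
    Holds (moveUp.run n S) 4
      (entries (Function.update p m (AccompliceGame.moveUp (p m) b k))) := by
  have key := run_each_inv (n := n) (v := 3) (c := moveUpAt) (S := S)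
    (fun j S => Holds S 0 (entries p) ∧ S.var 0 = m ∧ S.var 2 = k ∧ S.var 9 = b ∧
      -- Entries not yet visited still agree with `p`; this is needed at the positions outside of
      -- the moved segment, which are skipped. Reading from the array `0` keeps the old entries
      -- available while the array `4` is overwritten.
      (∀ i' j' : Fin n, i' ≠ m ∨ j ≤ j' → S.arr 4 i' j' = p i' j') ∧
      ∀ j' : Fin n, (j' : ℕ) < j → S.arr 4 m j' = AccompliceGame.moveUp (p m) b k j')
    ⟨h0, hm, hk, hb, fun i' j' _ => h4 i' j', fun _ h => absurd h (Nat.not_lt_zero _)⟩ (by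
      rintro j hj S ⟨h0, hm, hk, hb, h4, h4'⟩
      have v0 : (S.set 3 j).var 0 = m := by rw [Store.set_var_of_ne _ _ (by omega), hm]
      have v2 : (S.set 3 j).var 2 = k := by rw [Store.set_var_of_ne _ _ (by omega), hk]
      have v9 : (S.set 3 j).var 9 = b := by rw [Store.set_var_of_ne _ _ (by omega), hb]
      refine ⟨fun i' j' => ?_, ?_, ?_, ?_, ?_⟩
      · rw [run_arr (by simp [arrays, moveUpAt])]
        exact h0 i' j'
      · rw [run_var (by simp [vars, moveUpAt]), v0]
      · rw [run_var (by simp [vars, moveUpAt]), v2]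
      · rw [run_var (by simp [vars, moveUpAt]), v9]
      rcases moveUpAt_run (j := ⟨j, hj⟩) (S := S.set 3 j) hbk h0 v0 v2 v9 (S.set_var_self 3 j) with
        ⟨h1, h2⟩ | h1
      · rw [h1]
        refine ⟨fun i' j' h => h4 i' j' (by omega), fun j' h => ?_⟩
        by_cases hjj : (j' : ℕ) = j
        · obtain rfl : j' = ⟨j, hj⟩ := Fin.ext hjj
          rw [h2]
          exact h4 m _ (Or.inr le_rfl)
        · exact h4' j' (by omega)
      · rw [h1]
        refine ⟨fun i' j' h => ?_, fun j' h => ?_⟩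
        · simp only [Store.write, true_and, Store.set_arr]
          rw [if_neg, h4 i' j' (by omega)]
          rintro ⟨e1, e2⟩
          rcases h with h | h
          · exact h (Fin.ext e1)
          · omega
        · simp only [Store.write, true_and, Store.set_arr]
          by_cases hjj : (j' : ℕ) = j
          · obtain rfl : j' = ⟨j, hj⟩ := Fin.ext hjj
            rw [if_pos rfl]
          · rw [if_neg hjj]
            exact h4' j' (by omega))
  intro i j
  obtain ⟨-, -, -, -, h5, h6⟩ := key
  by_cases hi : i = m
  · subst hi
    rw [entries, Function.update_self]
    exact h6 j j.2
  · rw [entries, Function.update_of_ne hi]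
    exact h5 i j (Or.inl hi)

/-- The data on which `Cmd.push` relies. -/
structure HoldsGame (I : Market n) (P : Finset (Fin n × Fin n)) (S : Store) (p : Profile n) :
    Prop where
  lists : Holds S 0 (entries p)
  pairs : Holds S 2 fun m w => if (m, w) ∈ P then 1 else 0
  ranks : Holds S 3 (positions I.women)

theorem Holds.of_arr {S S' : Store} {a : ℕ} {f : Fin n → Fin n → ℕ} (h : Holds S a f)
    (hS : S'.arr a = S.arr a) : Holds S' a f := fun i j => by rw [hS]; exact h i j

theorem HoldsGame.of_arr {I : Market n} {P : Finset (Fin n × Fin n)} {S S' : Store}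
    {p : Profile n} (h : HoldsGame I P S p) (hS : S'.arr = S.arr) : HoldsGame I P S' p :=
  ⟨h.lists.of_arr (by rw [hS]), h.pairs.of_arr (by rw [hS]), h.ranks.of_arr (by rw [hS])⟩

theorem addressee_eval_DA {q p : Profile n} {S : Store} (hl : Holds S 4 (entries p))
    (hr : ∀ m : Fin n, S.arr 5 m m = daState q p (n * n) m) {v : ℕ} {m : Fin n}
    (hv : S.var v = m) : (Cmd.addressee v).eval n S = DA q p m :=
  addressee_eval hl hr hv (daState_lt q p _ m)

theorem Cmd.commit_holds {q p p' : Profile n} {m : Fin n} {S : Store}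
    (h0 : Holds S 0 (entries p)) (h4 : Holds S 4 (entries p'))
    (h5 : ∀ m : Fin n, S.arr 5 m m = daState q p' (n * n) m) (hm : S.var 0 = m)
    (h9 : S.var 9 = daState q p (n * n) m) :
    Holds (commit.run n S) 0 (entries (if DA q p' m = DA q p m then p' else p)) := by
  have e1 := addressee_eval_DA h4 h5 hm
  have e2 : (Expr.read 0 (.var 0) (.var 9)).eval n S = DA q p m := by
    have := h0 m ⟨_, daState_lt q p (n * n) m⟩
    simp only [entries] at this
    simp only [Expr.eval, hm, h9, Fin.is_lt, daState_lt, and_self, if_true, this]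
    rfl
  have e3 : (Expr.add (.sub (addressee 0) (.read 0 (.var 0) (.var 9)))
      (.sub (.read 0 (.var 0) (.var 9)) (addressee 0))).eval n S ≠ 0 ↔ DA q p' m ≠ DA q p m := by
    have : ∀ e f : Expr, ((e.sub f).add (f.sub e)).eval n S ≠ 0 ↔ e.eval n S ≠ f.eval n S :=
      fun e f => sub_add_sub_ne_zero
    rw [this, e1, e2, Ne, Fin.val_inj]
  simp only [commit, run, e3]
  by_cases hc : DA q p' m = DA q p m
  · rw [if_neg (not_not.2 hc), if_pos hc]
    exact copy_holds (by omega) h4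
  · rw [if_pos hc, if_neg hc]
    exact h0

/-- The array `4` carries the tentative list while the array `0` keeps the old one until `commit`.
The variable `9` remembers the old position of the partner, so the old partner can still be looked
up after the second run of deferred acceptance. -/
theorem Cmd.push_run {I : Market n} {P : Finset (Fin n × Fin n)} {S : Store} {p : Profile n}
    (h : HoldsGame I P S p) {m k : Fin n} (hm : S.var 0 = m) (hk : S.var 2 = k) :
    HoldsGame I P (push.run n S) (pushStep I.women m k p) := by
  refine ⟨?_, h.pairs.of_arr (run_arr (by decide) S), h.ranks.of_arr (run_arr (by decide) S)⟩
  set S₁ := (copy 4 0).run n S with hS₁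
  set S₂ := deferredAcceptance.run n S₁ with hS₂
  set S₃ := S₂.set 9 (daState I.women p (n * n) m) with hS₃
  have h4₁ : Holds S₁ 4 (entries p) := copy_holds (by omega) h.lists
  have h3₁ : Holds S₁ 3 (positions I.women) := h.ranks.of_arr (run_arr (by decide) S)
  have h0₁ : Holds S₁ 0 (entries p) := h.lists.of_arr (run_arr (by decide) S)
  have h5₂ : ∀ m : Fin n, S₂.arr 5 m m = daState I.women p (n * n) m :=
    deferredAcceptance_run h3₁ h4₁
  have h4₃ : Holds S₃ 4 (entries p) := h4₁.of_arr (run_arr (c := deferredAcceptance) (by decide) S₁)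
  have h3₃ : Holds S₃ 3 (positions I.women) :=
    h3₁.of_arr (run_arr (c := deferredAcceptance) (by decide) S₁)
  have h0₃ : Holds S₃ 0 (entries p) := h0₁.of_arr (run_arr (c := deferredAcceptance) (by decide) S₁)
  have hm₂ : S₂.var 0 = m := by rw [hS₂, run_var (by decide), hS₁, run_var (by decide), hm]
  have hk₂ : S₂.var 2 = k := by rw [hS₂, run_var (by decide), hS₁, run_var (by decide), hk]
  have hm₃ : S₃.var 0 = m := by rw [hS₃, Store.set_var_of_ne _ _ (by omega), hm₂]
  have hk₃ : S₃.var 2 = k := by rw [hS₃, Store.set_var_of_ne _ _ (by omega), hk₂]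
  have h9₃ : S₃.var 9 = daState I.women p (n * n) m := Store.set_var_self _ _ _
  have run_eq : push.run n S =
      if daState I.women p (n * n) m < k then
        commit.run n (deferredAcceptance.run n (moveUp.run n S₃)) else S₃ := by
    simp only [push, run, ← hS₁, ← hS₂, Expr.eval, hm₂, Fin.is_lt, and_self, if_true, h5₂, ← hS₃,
      hk₃, h9₃]
    split_ifs <;> first | rfl | omega
  rw [run_eq]
  have hpos : (p m).symm (DA I.women p m) < k ↔ daState I.women p (n * n) m < k := by
    rw [Fin.lt_def, position_DA]
  by_cases hlt : daState I.women p (n * n) m < k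
  · rw [if_pos hlt]
    have h9' : S₃.var 9 = ((p m).symm (DA I.women p m) : ℕ) := by rw [h9₃, position_DA]
    have h4₄ := moveUp_holds (hpos.2 hlt) h0₃ h4₃ hm₃ hk₃ h9'
    set S₄ := moveUp.run n S₃ with hS₄
    have h3₄ : Holds S₄ 3 (positions I.women) := h3₃.of_arr (run_arr (by decide) S₃)
    have h0₄ : Holds S₄ 0 (entries p) := h0₃.of_arr (run_arr (by decide) S₃)
    have h5₅ := deferredAcceptance_run h3₄ h4₄
    set S₅ := deferredAcceptance.run n S₄ with hS₅
    have h0₅ : Holds S₅ 0 (entries p) := h0₄.of_arr (run_arr (by decide) S₄)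
    have h4₅ := h4₄.of_arr (S' := S₅) (run_arr (by decide) S₄)
    have hm₅ : S₅.var 0 = m := by rw [hS₅, run_var (by decide), hS₄, run_var (by decide), hm₃]
    have h9₅ : S₅.var 9 = daState I.women p (n * n) m := by
      rw [hS₅, run_var (by decide), hS₄, run_var (by decide), h9₃]
    have := commit_holds h0₅ h4₅ h5₅ hm₅ h9₅
    unfold pushStep
    simpa only [hpos.2 hlt, true_and] using this
  · rw [if_neg hlt]
    unfold pushStep
    rw [if_neg fun hc => hlt (hpos.1 hc.1)]
    exact h0₃

theorem Cmd.equilibrium_run {I : Market n} {P : Finset (Fin n × Fin n)} {S : Store}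
    (h0 : Holds S 0 (entries I.men)) (h1 : Holds S 1 (entries I.women))
    (h2 : Holds S 2 fun m w => if (m, w) ∈ P then 1 else 0) :
    Holds (equilibrium.run n S) 0 (entries ((pushPass I P)^[n * n] I.men)) := by
  have hstart : HoldsGame I P (rank.run n S) I.men :=
    ⟨h0.of_arr (run_arr (by decide) S), h2.of_arr (run_arr (by decide) S), rank_holds h1⟩
  have hpass : ∀ (S : Store) (p : Profile n), HoldsGame I P S p →
      HoldsGame I P ((each 0 <| each 1 <|
        ite (.read 2 (.var 0) (.var 1)) (each 2 push) skip).run n S) (pushPass I P p) := by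
    intro S p h
    refine run_each_sweep (HoldsGame I P) (fun m S p h => ?_) h
    refine (run_each_sweep (fun S p => HoldsGame I P S p ∧ S.var 0 = m)
      (fun w S p h => ?_) ⟨h.of_arr (S.set_arr 0 m), S.set_var_self 0 m⟩).1
    have hv0 : (S.set 1 w).var 0 = m := by rw [Store.set_var_of_ne _ _ (by omega), h.2]
    have hv1 := S.set_var_self 1 w
    have hg := h.1.of_arr (S.set_arr 1 w)
    refine ⟨?_, by rw [run_var (by decide), hv0]⟩
    have hP := hg.pairs m w
    have he : (Expr.read 2 (.var 0) (.var 1)).eval n (S.set 1 w) ≠ 0 ↔ (m, w) ∈ P := by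
      simp only [Expr.eval, hv0, hv1, Fin.is_lt, and_self, if_true, hP]
      split_ifs with hmw <;> simp [hmw]
    simp only [run, he]
    split_ifs with hmw
    · refine (run_each_sweep (fun S p => HoldsGame I P S p ∧ S.var 0 = m)
        (fun k S p h => ?_) ⟨hg, hv0⟩).1
      have hv0 : (S.set 2 k).var 0 = m := by rw [Store.set_var_of_ne _ _ (by omega), h.2]
      exact ⟨push_run (h.1.of_arr (S.set_arr 2 k)) hv0 (S.set_var_self 2 k),
        by rw [run_var (by decide), hv0]⟩
    · exact hg
  have := run_each_sweep (n := n) (v := 7)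
    (c := each 8 <| each 0 <| each 1 <| ite (.read 2 (.var 0) (.var 1)) (each 2 push) skip)
    (f := fun _ => sweep fun _ => pushPass I P) (HoldsGame I P) (fun i S p h =>
      run_each_sweep (HoldsGame I P) (fun j S p h => hpass _ _ (h.of_arr (S.set_arr 8 j)))
        (h.of_arr (S.set_arr 7 i))) hstart
  rw [sweep_sweep_const] at this
  exact this.lists

/-! ### Input and output -/

theorem table_apply (f : Fin n → Fin n → ℕ) (i j : Fin n) : table f (n * i + j) = f i j := by
  have hlt : n * i + j < n * n :=
    calc n * (i : ℕ) + j < n * i + n := by have := j.2; omega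
      _ = n * (i + 1) := by ring
      _ ≤ n * n := Nat.mul_le_mul_left n i.2
  have hn : 0 < n := j.pos
  rw [table, dif_pos hlt]
  congr 1
  · exact Fin.ext (by simp [Nat.mul_add_div hn, Nat.div_eq_of_lt j.2])
  · exact Fin.ext (by simp [Nat.mod_eq_of_lt j.2])

/-- The arrays that the memory of a machine holds. -/
def RamState.store (n : ℕ) (s : RamState) : Store :=
  ⟨fun v => s.reg (2 * v + 1), fun a i j => s.mem ((a * n + i) * n + j)⟩

theorem RamState.represents_store (s : RamState) : Represents (s.reg 0) (s.store (s.reg 0)) s :=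
  ⟨rfl, fun _ => rfl, fun _ _ _ _ _ => rfl⟩

/-- The array `a` starts at the address `a * n * n`, exactly where the input puts its three tables,
so no data have to be moved. -/
theorem inputState_store (I : Market n) (P : Finset (Fin n × Fin n)) :
    Holds ((inputState I P).store n) 0 (entries I.men) ∧
      Holds ((inputState I P).store n) 1 (entries I.women) ∧
      Holds ((inputState I P).store n) 2 fun m w => if (m, w) ∈ P then 1 else 0 := by
  have hlt : ∀ i j : Fin n, n * (i : ℕ) + j < n * n := fun i j =>
    calc n * (i : ℕ) + j < n * i + n := by have := j.2; omega
      _ = n * (i + 1) := by ring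
      _ ≤ n * n := Nat.mul_le_mul_left n i.2
  refine ⟨fun i j => ?_, fun i j => ?_, fun i j => ?_⟩
  all_goals
    have h := hlt i j
    simp only [RamState.store, inputState]
  · rw [show (0 * n + i) * n + j = n * i + (j : ℕ) by ring, if_pos h, table_apply]
    rfl
  · rw [show (1 * n + i) * n + j = n * n + (n * i + (j : ℕ)) by ring, if_neg (by omega),
      if_pos (by omega), Nat.add_sub_cancel_left, table_apply]
    rfl
  · rw [show (2 * n + i) * n + j = 2 * (n * n) + (n * i + (j : ℕ)) by ring, if_neg (by omega),
      if_neg (by omega), Nat.add_sub_cancel_left, table_apply]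

theorem exists_program_isNashEquilibrium :
    ∃ (c : Program) (T : Polynomial ℕ), ∀ (n : ℕ) (I : Market n) (P : Finset (Fin n × Fin n)),
      ∃ (t : ℕ) (s : RamState) (p : Profile n),
        Exec c (inputState I P) t s ∧ t ≤ T.eval n ∧ IsOutput s p ∧ IsNashEquilibrium I P p := by
  refine ⟨Cmd.equilibrium.compile 0, Cmd.equilibrium.cost, fun n I P => ?_⟩
  have hrep : Represents n ((inputState I P).store n) (inputState I P) :=
    (inputState I P).represents_store
  obtain ⟨t, s, h1, h2, h3, -⟩ := Cmd.equilibrium.compile_exec 0 _ _ hrep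
  obtain ⟨hm, hw, hp⟩ := inputState_store I P
  refine ⟨t, s, _, h1, h2, fun m k => ?_, isNashEquilibrium_pushPass I P⟩
  rw [show n * (m : ℕ) + k = (0 * n + m) * n + k by ring, h3.arr 0 m k m.2 k.2]
  exact Cmd.equilibrium_run hm hw hp m k

end AccompliceGame

/-- First: every accomplice manipulation game has a pure-strategy Nash equilibrium. Second: along
every push-up dynamic the stable sets shrink and the women improve, and it reaches, within `n ^ 2`
steps, a fixed point, which is a Nash equilibrium. Third: one program computes a Nash equilibrium of
every game in time polynomial in `n`. -/
theorem theorem1 :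
    (∀ (n : ℕ) (I : Market n) (P : Finset (Fin n × Fin n)),
      ∃ p : Profile n, IsNashEquilibrium I P p) ∧
    (∀ (n : ℕ) (I : Market n) (P : Finset (Fin n × Fin n)) (p : ℕ → Profile n),
      IsPushUpDynamic I P p →
        (∀ t, stableSet I.women (p (t + 1)) ⊆ stableSet I.women (p t)) ∧
        (∀ t, p (t + 1) ≠ p t →
          (∀ w, WeaklyPrefers (I.women w)
            ((DA I.women (p (t + 1))).symm w) ((DA I.women (p t)).symm w)) ∧
          ∃ w, Prefers (I.women w)
            ((DA I.women (p (t + 1))).symm w) ((DA I.women (p t)).symm w)) ∧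
        ∃ t ≤ n ^ 2, (∀ s ≥ t, p s = p t) ∧ IsNashEquilibrium I P (p t)) ∧
    (∃ (c : Program) (T : Polynomial ℕ),
      ∀ (n : ℕ) (I : Market n) (P : Finset (Fin n × Fin n)),
        ∃ (t : ℕ) (s : RamState) (p : Profile n),
          Exec c (inputState I P) t s ∧ t ≤ T.eval n ∧ IsOutput s p ∧
            IsNashEquilibrium I P p) :=
  ⟨fun _ I P => ⟨_, isNashEquilibrium_pushPass I P⟩, fun _ _ _ _ h => pushUpDynamic_spec h,
    exists_program_isNashEquilibrium⟩
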